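/- **Separation systems and tree sets.** A *separation system* is a partially ordered set with an order-reversing involution ${}^*$. The *unoriented separation* of an element $s$ is $\{s,s^*\}$, and $s,s^*$ are its *orientations*. A subset $\tau$ closed under ${}^*$, with the induced order, is a *tree set* if any two of its unoriented separations have comparable orientations and no $s\in\tau$ is *trivial*, i.e. there is no $r\in\tau$ with $\{r,r^*\}\ne\{s,s^*\}$, $s\le r$ and $s\le r^*$. It is *regular* if $s\not\le s^*$ for all $s\in\tau$. An *orientation* of $\tau$ is a set $O\subseteq\tau$ with $|O\cap\{s,s^*\}|=1$ for all $s\in\tau$; it is *consistent* if $s^*\le r$ with $r,s\in O$ implies $\{r,r^*\}=\{s,s^*\}$. **Graph-like spaces.** A *graph-like space* $G$ is a Hausdorff topological space with a vertex set $V(G)$, an edge set $E(G)$ and continuous maps $\iota_e:[0,1]\to G$ for $e\in E(G)$ such that (up to the obvious identification) $G$ is the disjoint union of $V(G)$ and $(0,1)\times E(G)$; $\iota_e(x)=(x,e)$ for $0<x<1$; $\iota_e(0),\iota_e(1)\in V(G)$ (the end-vertices of $e$); $\iota_e$ restricted to $(0,1)$ is an open map; and for any distinct $v,v'\in V(G)$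 there are disjoint open sets $U\ni v$, $U'\ni v'$ of $G$ with $V(G)\subseteq U\cup U'$. An *isomorphism* of graph-like spaces is a homeomorphism that restricts to a bijection between the vertex sets. For $F\subseteq E(G)$, $G-F$ is the subspace obtained by removing the inner points $(0,1)\times F$ (with edge set $E(G)\setminus F$), and for a set $W$ of vertices that are not end-vertices of edges, $G-W$ is the subspace $G\setminus W$. For $F\subseteq E(G)$ let $\sim_F$ be the smallest equivalence relation on $G$ such that $\iota_e(x)\sim_F\iota_e(y)$ for all $e\in F$ and $x,y\in[0,1]$, and such that the quotient space $G/{\sim_F}$ is a (Hausdorff) graph-like space with vertex set $\{[v] : v\in V(G)\}$, edge set $E(G)\setminus F$ and the edge maps induced by the $\iota_e$ with $e\notin F$. (Such a smallest relation exists.) The *contraction* $G/F$ is this graph-like space, and $G.F:=G/(E(G)\setminus F)$. A graph-like space $G'$ is a *minor* of $G$ if $G'$ is isomorphic to $((G/F_1)-F_2)-W$ for some disjoint $F_1,F_2\subseteq E(G)$ and some set $W$ of vertices of $(G/F_1)-F_2$ that are not end-vertices. **The space $T(\tau)$.** Let $\tau$ be a regular tree set. Fix any orientation $D$ of $\tau$.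 The graph-like space $T(\tau)$ has as vertices all consistent orientations of $\tau$ and as edges all unoriented separations of $\tau$. For $s\in\tau$ let $O(s)$ be the unique consistent orientation of $\tau$ in which $s$ is maximal. If $s\in D$ and $e=\{s,s^*\}$, then $\iota_e(0)=O(s^*)$ and $\iota_e(1)=O(s)$. The topology is generated by the sets $S(s,r)$, $s\in\tau$, $r\in(0,1)$, where $S(s,r)$ consists of all vertices $O$ with $s\in O$, all inner points of edges that have an orientation $t$ with $s<t$, and the points $(x,\{s,s^*\})$ with $x\in(r,1)$ if $s\in D$, and with $x\in(0,r)$ if $s\notin D$. **Theorem.** Let $\tau_1\subseteq\tau_2$ be regular tree sets (with $\tau_1$ carrying the order and involution of $\tau_2$). Then, for any choice of the orientations of $\tau_1$ and $\tau_2$ in the constructions of $T(\tau_1)$ and $T(\tau_2)$, the graph-like space $T(\tau_1)$ is a minor of $T(\tau_2)$. More precisely, $T(\tau_1)$ is isomorphic to the contraction $T(\tau_2).E(T(\tau_1))$, where $E(T(\tau_1))\subseteq E(T(\tau_2))$ is the set of unoriented separations of $\tau_1$. -/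

import Mathlib

/-! ### Separation systems and tree sets -/

/-- A separation system: a partially ordered set with an order-reversing involution. -/
class SeparationSystem (α : Type*) extends PartialOrder α where
  inv : α → α
  inv_inv : ∀ s, inv (inv s) = s
  inv_le_inv : ∀ {r s}, r ≤ s → inv s ≤ inv r

namespace SeparationSystem

variable {α : Type*} [SeparationSystem α]

/-- The unoriented separation underlying an oriented one. -/
def unoriented (s : α) : Set α := {s, inv s}

/-- `s` is small. -/
def IsSmall (s : α) : Prop := s ≤ inv s

/-- `s` is regular: neither orientation is small. -/
def IsRegular (s : α) : Prop := ¬ IsSmall s ∧ ¬ IsSmall (inv s)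

/-- `s` is trivial in `τ`. -/
def IsTrivialIn (τ : Set α) (s : α) : Prop :=
  ∃ r ∈ τ, s ≤ r ∧ s ≤ inv r ∧ unoriented s ≠ unoriented r

/-- Two separations are nested if they have comparable orientations. -/
def Nested (r s : α) : Prop :=
  ∃ r' ∈ unoriented r, ∃ s' ∈ unoriented s, r' ≤ s' ∨ s' ≤ r'

/-- A subset `τ` of a separation system that is closed under the involution is itself a separation
system, with the induced order.  It is a tree set if it is nested and has no trivial elements. -/
structure IsTreeSet (τ : Set α) : Prop where
  inv_mem : ∀ s ∈ τ, inv s ∈ τ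
  nested : ∀ r ∈ τ, ∀ s ∈ τ, Nested r s
  nontrivial : ∀ s ∈ τ, ¬ IsTrivialIn τ s

/-- A regular tree set. -/
structure IsRegularTreeSet (τ : Set α) : Prop extends IsTreeSet τ where
  regular : ∀ s ∈ τ, IsRegular s

/-- An orientation of `τ` contains exactly one orientation of each separation in `τ`. -/
structure IsOrientation (τ O : Set α) : Prop where
  subset : O ⊆ τ
  existsUnique : ∀ s ∈ τ, ∃! x, x ∈ O ∧ x ∈ unoriented s

/-- Consistency of an orientation. -/
def IsConsistent (O : Set α) : Prop :=
  ∀ r ∈ O, ∀ s ∈ O, inv s ≤ r → unoriented r = unoriented s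

/-- The set of all consistent orientations of `τ`. -/
def ConsistentOrientation (τ : Set α) : Type _ :=
  {O : Set α // IsOrientation τ O ∧ IsConsistent O}

/-- The set of unoriented separations of `τ`. -/
def UnorientedSep (τ : Set α) : Type _ := {e : Set α // ∃ s ∈ τ, e = unoriented s}

theorem inv_le_iff {r s : α} : inv r ≤ s ↔ inv s ≤ r :=
  ⟨fun h => by simpa [inv_inv] using inv_le_inv h, fun h => by simpa [inv_inv] using inv_le_inv h⟩

theorem le_inv_iff {r s : α} : r ≤ inv s ↔ s ≤ inv r :=
  ⟨fun h => by simpa [inv_inv] using inv_le_inv h, fun h => by simpa [inv_inv] using inv_le_inv h⟩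

theorem inv_le_inv_iff {r s : α} : inv r ≤ inv s ↔ s ≤ r :=
  ⟨fun h => by simpa [inv_inv] using inv_le_inv h, inv_le_inv⟩

theorem inv_lt_inv_iff {r s : α} : inv r < inv s ↔ s < r := by
  simp [lt_iff_le_not_ge, inv_le_inv_iff]

theorem lt_inv_iff {r s : α} : r < inv s ↔ s < inv r := by
  rw [← inv_lt_inv_iff, inv_inv]

theorem inv_lt_iff {r s : α} : inv r < s ↔ inv s < r := by
  rw [← inv_lt_inv_iff, inv_inv]

theorem inv_eq_iff {r s : α} : inv r = s ↔ r = inv s :=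
  ⟨fun h => by rw [← h, inv_inv], fun h => by rw [h, inv_inv]⟩

theorem mem_unoriented {r s : α} : r ∈ unoriented s ↔ r = s ∨ r = inv s := Iff.rfl

theorem unoriented_eq_iff {r s : α} : unoriented r = unoriented s ↔ r = s ∨ r = inv s := by
  constructor
  · intro h
    have : r ∈ unoriented s := h ▸ (Or.inl rfl : r ∈ unoriented r)
    exact this
  · rintro (rfl | rfl)
    · rfl
    · simp [unoriented, inv_inv, Set.pair_comm]

namespace IsRegularTreeSet

variable {τ : Set α}

theorem not_le_inv (hτ : IsRegularTreeSet τ) {s : α} (hs : s ∈ τ) : ¬ s ≤ inv s :=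
  (hτ.regular s hs).1

theorem not_inv_le (hτ : IsRegularTreeSet τ) {s : α} (hs : s ∈ τ) : ¬ inv s ≤ s := fun h =>
  (hτ.regular s hs).2 (by simpa [IsSmall, inv_inv] using h)

theorem compare (hτ : IsRegularTreeSet τ) {r s : α} (hr : r ∈ τ) (hs : s ∈ τ) :
    r ≤ s ∨ s ≤ r ∨ r ≤ inv s ∨ inv s ≤ r := by
  obtain ⟨r', hr', s', hs', h⟩ := hτ.nested r hr s hs
  rcases hr' with rfl | rfl <;> rcases hs' with rfl | rfl <;> rcases h with h | h
  · exact Or.inl h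
  · exact Or.inr (Or.inl h)
  · exact Or.inr (Or.inr (Or.inl h))
  · exact Or.inr (Or.inr (Or.inr h))
  · exact Or.inr (Or.inr (Or.inr (inv_le_iff.1 h)))
  · exact Or.inr (Or.inr (Or.inl (le_inv_iff.1 h)))
  · exact Or.inr (Or.inl (inv_le_inv_iff.1 h))
  · exact Or.inl (inv_le_inv_iff.1 h)

end IsRegularTreeSet

theorem IsOrientation.mem_or {τ O : Set α} (hO : IsOrientation τ O) {s : α} (hs : s ∈ τ) :
    s ∈ O ∨ inv s ∈ O := by
  obtain ⟨x, ⟨hx, hxs⟩, -⟩ := hO.existsUnique s hs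
  rcases hxs with rfl | rfl
  · exact Or.inl hx
  · exact Or.inr hx

theorem IsOrientation.not_both {τ O : Set α} (hτ : IsRegularTreeSet τ) (hO : IsOrientation τ O)
    {s : α} (h1 : s ∈ O) (h2 : inv s ∈ O) : False := by
  have hs := hO.subset h1
  have := (hO.existsUnique s hs).unique ⟨h1, Or.inl rfl⟩ ⟨h2, Or.inr rfl⟩
  exact hτ.not_le_inv hs this.le

theorem IsOrientation.inv_mem_iff {τ O : Set α} (hτ : IsRegularTreeSet τ) (hO : IsOrientation τ O)
    {s : α} (hs : s ∈ τ) : inv s ∈ O ↔ s ∉ O :=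
  ⟨fun h h' => hO.not_both hτ h' h, fun h => (hO.mem_or hs).resolve_left h⟩

/-- The unique consistent orientation of the regular tree set `τ` in which `s` is maximal; see
`existsUnique_maximal` and `maximal_maxOrientation` below. -/
def maxOrientation {τ : Set α} (hτ : IsRegularTreeSet τ) (s : α) (hs : s ∈ τ) :
    ConsistentOrientation τ :=
  ⟨{r | r ∈ τ ∧ (r ≤ s ∨ r < inv s)}, by
    constructor
    · refine ⟨fun r hr => hr.1, fun r hr => ?_⟩
      have key : ∀ r ∈ τ, (r ≤ s ∨ r < inv s) → (inv r ≤ s ∨ inv r < inv s) → False := by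
        rintro r hr (h | h) (h' | h')
        · exact hτ.not_inv_le hs ((inv_le_inv h).trans h')
        · exact absurd h (inv_lt_inv_iff.1 h').not_ge
        · exact absurd h' (lt_inv_iff.1 h).not_ge
        · exact hτ.not_le_inv hs ((inv_lt_inv_iff.1 h').le.trans h.le)
      have ex : (r ≤ s ∨ r < inv s) ∨ (inv r ≤ s ∨ inv r < inv s) := by
        rcases hτ.compare hr hs with h | h | h | h
        · exact Or.inl (Or.inl h)
        · rcases h.eq_or_lt with rfl | h
          · exact Or.inl (Or.inl le_rfl)
          · exact Or.inr (Or.inr (inv_lt_inv_iff.2 h))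
        · rcases h.eq_or_lt with rfl | h
          · exact Or.inr (Or.inl (by rw [inv_inv]))
          · exact Or.inl (Or.inr h)
        · exact Or.inr (Or.inl (inv_le_iff.1 h))
      rcases ex with h | h
      · refine ⟨r, ⟨⟨hr, h⟩, Or.inl rfl⟩, ?_⟩
        rintro y ⟨⟨-, hy⟩, rfl | rfl⟩
        · rfl
        · exact (key r hr h hy).elim
      · refine ⟨inv r, ⟨⟨hτ.inv_mem r hr, h⟩, Or.inr rfl⟩, ?_⟩
        rintro y ⟨⟨-, hy⟩, rfl | rfl⟩
        · exact (key _ hr hy h).elim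
        · rfl
    · rintro r ⟨hr, h⟩ t ⟨ht, h'⟩ htr
      rw [unoriented_eq_iff]
      rcases h with h | h <;> rcases h' with h' | h'
      · exact (hτ.not_inv_le hs ((inv_le_inv h').trans (htr.trans h))).elim
      · exact (((lt_inv_iff.1 h').trans_le htr).not_ge h).elim
      · have := (inv_le_inv h').trans htr
        exact absurd h this.not_gt
      · exact (hτ.not_le_inv hs ((lt_inv_iff.1 h').le.trans (htr.trans h.le))).elim⟩

theorem mem_maxOrientation {τ : Set α} (hτ : IsRegularTreeSet τ) {s : α} (hs : s ∈ τ) {r : α} :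
    r ∈ (maxOrientation hτ s hs).1 ↔ r ∈ τ ∧ (r ≤ s ∨ r < inv s) := Iff.rfl

theorem maximal_maxOrientation {τ : Set α} (hτ : IsRegularTreeSet τ) (s : α) (hs : s ∈ τ) :
    Maximal (· ∈ (maxOrientation hτ s hs).1) s := by
  refine ⟨⟨hs, Or.inl le_rfl⟩, ?_⟩
  rintro r ⟨hr, h | h⟩ hsr
  · exact h
  · exact (hτ.not_le_inv hs (hsr.trans h.le)).elim

theorem existsUnique_maximal {τ : Set α} (hτ : IsRegularTreeSet τ) (s : α) (hs : s ∈ τ) :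
    ∃! O : ConsistentOrientation τ, Maximal (· ∈ O.1) s := by
  refine ⟨maxOrientation hτ s hs, maximal_maxOrientation hτ s hs, ?_⟩
  have sub : ∀ O : ConsistentOrientation τ, Maximal (· ∈ O.1) s →
      ∀ r ∈ O.1, r ∈ (maxOrientation hτ s hs).1 := by
    rintro ⟨O, hO, hc⟩ hm r hr
    refine ⟨hO.subset hr, ?_⟩
    rcases hτ.compare (hO.subset hr) hs with h | h | h | h
    · exact Or.inl h
    · exact Or.inl (hm.2 hr h)
    · rcases h.eq_or_lt with rfl | h
      · exact (hO.not_both hτ hm.1 hr).elim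
      · exact Or.inr h
    · rcases unoriented_eq_iff.1 (hc r hr s hm.1 h) with rfl | rfl
      · exact Or.inl le_rfl
      · exact (hO.not_both hτ hm.1 hr).elim
  intro O hm
  refine Subtype.ext (Set.Subset.antisymm (sub O hm) fun r hr => ?_)
  by_contra hr'
  have h1 := sub O hm _ ((O.2.1.inv_mem_iff hτ hr.1).2 hr')
  exact (maxOrientation hτ s hs).2.1.not_both hτ hr h1

end SeparationSystem

/-! ### Graph-like spaces -/

/-- The conditions on a topological space `P` with vertex set `V`, edge set `E` and edge maps `ι` to
be a graph-like space.  The points outside `V` are identified with the pairs of an edge `e` and a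
number `x` strictly between `0` and `1` through `ι`. -/
structure IsGraphLike {P E : Type*} [TopologicalSpace P] (V : Set P) (ι : E → unitInterval → P) :
    Prop where
  continuous : ∀ e, Continuous (ι e)
  compl_vertices : ∀ p, p ∉ V ↔ ∃ e, ∃ x, 0 < x ∧ x < 1 ∧ ι e x = p
  injective : ∀ e e' x x', 0 < x → x < 1 → 0 < x' → x' < 1 → ι e x = ι e' x' → e = e' ∧ x = x'
  zero_mem : ∀ e, ι e 0 ∈ V
  one_mem : ∀ e, ι e 1 ∈ V
  isOpen_image : ∀ e, ∀ s : Set unitInterval, IsOpen s → s ⊆ Set.Ioo 0 1 → IsOpen (ι e '' s)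
  separated : ∀ v ∈ V, ∀ v' ∈ V, v ≠ v' → ∃ U U' : Set P, IsOpen U ∧ IsOpen U' ∧ Disjoint U U' ∧
    V ⊆ U ∪ U' ∧ v ∈ U ∧ v' ∈ U'
  hausdorff : T2Space P

universe u v

set_option linter.checkUnivs false in
/-- A graph-like space, bundled: its points, its edge set `E(G)`, its topology, its vertex set `V(G)`
and the maps `ι_e`. -/
structure GraphLikeSpace where
  Point : Type u
  Edge : Type v
  [topology : TopologicalSpace Point]
  vertexSet : Set Point
  ι : Edge → unitInterval → Point
  isGraphLike : IsGraphLike vertexSet ι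

attribute [instance] GraphLikeSpace.topology

namespace IsGraphLike

variable {P E : Type*} [TopologicalSpace P] {V : Set P} {ι : E → unitInterval → P}

theorem inner_notMem (h : IsGraphLike V ι) {e : E} {x : unitInterval} (h0 : 0 < x) (h1 : x < 1) :
    ι e x ∉ V := (h.compl_vertices _).2 ⟨e, x, h0, h1, rfl⟩

theorem mem_cases (h : IsGraphLike V ι) (p : P) :
    p ∈ V ∨ ∃ e, ∃ x, 0 < x ∧ x < 1 ∧ ι e x = p := by
  by_cases hp : p ∈ V
  · exact Or.inl hp
  · exact Or.inr ((h.compl_vertices p).1 hp)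

/-- Subspaces that contain all points of the edges they keep. -/
theorem restrict (h : IsGraphLike V ι) (A : Set P) {D : Type*} (j : D → E)
    (hj : Function.Injective j) (hD : ∀ d, ∀ x, ι (j d) x ∈ A)
    (hA : ∀ e, ∀ x, 0 < x → x < 1 → ι e x ∈ A → ∃ d, j d = e) :
    IsGraphLike (P := A) (E := D) (Subtype.val ⁻¹' V) (fun d x => ⟨ι (j d) x, hD d x⟩) where
  continuous e := (h.continuous (j e)).subtype_mk _
  compl_vertices p := by
    constructor
    · intro hp
      obtain ⟨e, x, h0, h1, hx⟩ := (h.compl_vertices p.1).1 hp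
      obtain ⟨d, rfl⟩ := hA e x h0 h1 (hx ▸ p.2)
      exact ⟨d, x, h0, h1, Subtype.ext hx⟩
    · rintro ⟨e, x, h0, h1, rfl⟩
      exact h.inner_notMem h0 h1
  injective e e' x x' h0 h1 h0' h1' heq := by
    obtain ⟨a, b⟩ := h.injective (j e) (j e') x x' h0 h1 h0' h1' (congrArg Subtype.val heq)
    exact ⟨hj a, b⟩
  zero_mem e := h.zero_mem (j e)
  one_mem e := h.one_mem (j e)
  isOpen_image e s hs hs' := by
    refine ⟨ι (j e) '' s, h.isOpen_image (j e) s hs hs', ?_⟩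
    ext p
    constructor
    · rintro ⟨x, hx, hxp⟩
      exact ⟨x, hx, Subtype.ext hxp⟩
    · rintro ⟨x, hx, rfl⟩
      exact ⟨x, hx, rfl⟩
  separated v hv v' hv' hne := by
    obtain ⟨U, U', hU, hU', hd, hc, h1, h2⟩ :=
      h.separated v.1 hv v'.1 hv' (fun hh => hne (Subtype.ext hh))
    exact ⟨Subtype.val ⁻¹' U, Subtype.val ⁻¹' U', hU.preimage continuous_subtype_val,
      hU'.preimage continuous_subtype_val, hd.preimage _, fun p hp => hc hp, h1, h2⟩
  hausdorff := by
    have := h.hausdorff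
    infer_instance

end IsGraphLike

namespace GraphLikeSpace

/-- The edge maps of the quotient of `G` by `r`, for the edges of `G` outside `F`. -/
def quotientι (G : GraphLikeSpace) (F : Set G.Edge) (r : Setoid G.Point) :
    {e : G.Edge // e ∉ F} → unitInterval → Quotient r :=
  fun e x => Quotient.mk r (G.ι e.1 x)

/-- The equivalence relations `r` on `G` that identify all points `ι_e(x)`, `0 ≤ x ≤ 1`, for each
`e ∈ F`, and for which the quotient space is a (Hausdorff) graph-like space with vertices the
classes of vertices of `G`, with edge set `E(G) \ F` and with the edge maps induced by those
of `G`. -/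
def IsContracting (G : GraphLikeSpace) (F : Set G.Edge) (r : Setoid G.Point) : Prop :=
  (∀ e ∈ F, ∀ x y, r (G.ι e x) (G.ι e y)) ∧
    IsGraphLike (Quotient.mk r '' G.vertexSet) (G.quotientι F r)

/-- The smallest of these equivalence relations; that it belongs to them is
`isContracting_contractionRel` below. -/
def contractionRel (G : GraphLikeSpace) (F : Set G.Edge) : Setoid G.Point :=
  sInf {r | G.IsContracting F r}

theorem contractionRel_le {G : GraphLikeSpace} {F : Set G.Edge} {r : Setoid G.Point}
    (h : G.IsContracting F r) : G.contractionRel F ≤ r := sInf_le h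

theorem contractionRel_iff {G : GraphLikeSpace} {F : Set G.Edge} {p q : G.Point} :
    G.contractionRel F p q ↔ ∀ r, G.IsContracting F r → r p q := Iff.rfl

/-- In the quotient by a contracting relation, classes of inner points of edges outside `F` are
singletons. -/
theorem IsContracting.eq_of_rel {G : GraphLikeSpace} {F : Set G.Edge} {r : Setoid G.Point}
    (h : G.IsContracting F r) {e : G.Edge} (he : e ∉ F) {x : unitInterval} (h0 : 0 < x)
    (h1 : x < 1) {q : G.Point} (hq : r (G.ι e x) q) : q = G.ι e x := by
  have hv : ∀ v ∈ G.vertexSet, ¬ r (G.ι e x) v := fun v hv hr =>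
    h.2.inner_notMem (e := ⟨e, he⟩) h0 h1 ⟨v, hv, Quotient.sound (r.symm hr)⟩
  rcases G.isGraphLike.mem_cases q with hqv | ⟨f, y, h0', h1', rfl⟩
  · exact (hv q hqv hq).elim
  · by_cases hf : f ∈ F
    · exact (hv _ (G.isGraphLike.zero_mem f) (r.trans hq (h.1 f hf y 0))).elim
    · obtain ⟨a, b⟩ := h.2.injective ⟨e, he⟩ ⟨f, hf⟩ x y h0 h1 h0' h1' (Quotient.sound hq)
      cases a
      rw [b]

/-- The relation that identifies all vertices and all points of edges in `F`. -/
def collapseSetoid (G : GraphLikeSpace) (A : Set G.Point) : Setoid G.Point where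
  r p q := p = q ∨ (p ∈ A ∧ q ∈ A)
  iseqv := by
    refine ⟨fun p => Or.inl rfl, ?_, ?_⟩
    · rintro p q (rfl | ⟨h1, h2⟩)
      · exact Or.inl rfl
      · exact Or.inr ⟨h2, h1⟩
    · rintro p q s (rfl | ⟨h1, h2⟩) (rfl | ⟨h3, h4⟩)
      · exact Or.inl rfl
      · exact Or.inr ⟨h3, h4⟩
      · exact Or.inr ⟨h1, h2⟩
      · exact Or.inr ⟨h1, h4⟩

theorem exists_isContracting (G : GraphLikeSpace) (F : Set G.Edge) :
    ∃ r, G.IsContracting F r := by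
  have hG := G.isGraphLike
  have hT2 := hG.hausdorff
  let A : Set G.Point := {p | p ∈ G.vertexSet ∨ ∃ e ∈ F, ∃ x, G.ι e x = p}
  have hAV : ∀ v ∈ G.vertexSet, v ∈ A := fun v hv => Or.inl hv
  have hAc : ∀ e, e ∉ F → ∀ x, 0 < x → x < 1 → G.ι e x ∉ A := by
    rintro e he x h0 h1 (h | ⟨f, hf, y, hy⟩)
    · exact hG.inner_notMem h0 h1 h
    · have hy0 : 0 < y := by
        refine lt_of_le_of_ne y.2.1 ?_
        rintro rfl
        exact hG.inner_notMem h0 h1 (hy ▸ hG.zero_mem f)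
      have hy1 : y < 1 := by
        refine lt_of_le_of_ne y.2.2 ?_
        rintro rfl
        exact hG.inner_notMem h0 h1 (hy ▸ hG.one_mem f)
      exact he ((hG.injective f e y x hy0 hy1 h0 h1 hy).1 ▸ hf)
  have hcases : ∀ p, p ∈ A ∨ ∃ e, e ∉ F ∧ ∃ x, 0 < x ∧ x < 1 ∧ G.ι e x = p := by
    intro p
    rcases hG.mem_cases p with h | ⟨e, x, h0, h1, hx⟩
    · exact Or.inl (Or.inl h)
    · by_cases he : e ∈ F
      · exact Or.inl (Or.inr ⟨e, he, x, hx⟩)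
      · exact Or.inr ⟨e, he, x, h0, h1, hx⟩
  let r := G.collapseSetoid A
  have hr : ∀ p q, r p q ↔ p = q ∨ (p ∈ A ∧ q ∈ A) := fun p q => Iff.rfl
  -- saturated open sets have open images
  have hopen : ∀ U : Set G.Point, IsOpen U → (U ∩ A = ∅ ∨ A ⊆ U) →
      IsOpen (Quotient.mk r '' U) ∧ Quotient.mk r ⁻¹' (Quotient.mk r '' U) = U := by
    intro U hU hs
    have hsat : Quotient.mk r ⁻¹' (Quotient.mk r '' U) = U := by
      refine Set.Subset.antisymm ?_ (Set.subset_preimage_image _ _)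
      rintro p ⟨q, hq, hqp⟩
      rcases (hr q p).1 (Quotient.exact hqp) with rfl | ⟨h1, h2⟩
      · exact hq
      · rcases hs with hs | hs
        · exact (Set.notMem_empty q (hs ▸ ⟨hq, h1⟩)).elim
        · exact hs h2
    refine ⟨?_, hsat⟩
    rw [← isQuotientMap_quotient_mk'.isOpen_preimage]
    exact hsat.symm ▸ hU
  have sep : ∀ e, e ∉ F → ∀ x, 0 < x → x < 1 → ∀ q, q ∈ A →
      ∃ U U' : Set (Quotient r), IsOpen U ∧ IsOpen U' ∧ Quotient.mk r (G.ι e x) ∈ U ∧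
        Quotient.mk r q ∈ U' ∧ Disjoint U U' := by
    intro e he x h0 h1 q hq
    obtain ⟨a, ha0, hax⟩ := exists_between h0
    obtain ⟨b, hxb, hb1⟩ := exists_between h1
    have hK : IsClosed (G.ι e '' Set.Icc a b) :=
      (isCompact_Icc.image (hG.continuous e)).isClosed
    obtain ⟨o1, s1⟩ := hopen (G.ι e '' Set.Ioo a b)
      (hG.isOpen_image e _ isOpen_Ioo (fun y hy => ⟨ha0.trans hy.1, hy.2.trans hb1⟩))
      (Or.inl (by
        rw [Set.eq_empty_iff_forall_notMem]
        rintro _ ⟨⟨y, hy, rfl⟩, hyA⟩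
        exact hAc e he y (ha0.trans hy.1) (hy.2.trans hb1) hyA))
    obtain ⟨o2, s2⟩ := hopen (G.ι e '' Set.Icc a b)ᶜ hK.isOpen_compl
      (Or.inr (by
        rintro p hp ⟨y, hy, rfl⟩
        exact hAc e he y (ha0.trans_le hy.1) (hy.2.trans_lt hb1) hp))
    refine ⟨_, _, o1, o2, ⟨_, ⟨x, ⟨hax, hxb⟩, rfl⟩, rfl⟩, ⟨q, ?_, rfl⟩, ?_⟩
    · rintro ⟨y, hy, rfl⟩
      exact hAc e he y (ha0.trans_le hy.1) (hy.2.trans_lt hb1) hq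
    · rw [Set.disjoint_left]
      rintro c hc hc'
      induction c using Quotient.inductionOn with
      | h p =>
        have hp1 : p ∈ G.ι e '' Set.Ioo a b := by rw [← s1]; exact hc
        have hp2 : p ∈ (G.ι e '' Set.Icc a b)ᶜ := by rw [← s2]; exact hc'
        exact hp2 (Set.image_mono Set.Ioo_subset_Icc_self hp1)
  refine ⟨r, ?_, ?_⟩
  · intro e he x y
    exact Or.inr ⟨Or.inr ⟨e, he, x, rfl⟩, Or.inr ⟨e, he, y, rfl⟩⟩
  · refine ⟨?_, ?_, ?_, ?_, ?_, ?_, ?_, ?_⟩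
    · intro e
      exact continuous_quotient_mk'.comp (hG.continuous e.1)
    · intro c
      constructor
      · intro hc
        induction c using Quotient.inductionOn with
        | h p =>
          rcases hcases p with hp | ⟨e, he, x, h0, h1, rfl⟩
          · exfalso
            rcases hp with hp | ⟨e, he, x, rfl⟩
            · exact hc ⟨p, hp, rfl⟩
            · exact hc ⟨G.ι e 0, hG.zero_mem e, Quotient.sound
                (Or.inr ⟨Or.inl (hG.zero_mem e), Or.inr ⟨e, he, x, rfl⟩⟩)⟩
          · exact ⟨⟨e, he⟩, x, h0, h1, rfl⟩
      · rintro ⟨e, x, h0, h1, rfl⟩ ⟨v, hv, hvx⟩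
        rcases (hr _ _).1 (Quotient.exact hvx) with h | ⟨-, h⟩
        · exact hG.inner_notMem h0 h1 (h ▸ hv)
        · exact hAc e.1 e.2 x h0 h1 h
    · intro e e' x x' h0 h1 h0' h1' heq
      rcases (hr _ _).1 (Quotient.exact heq) with h | ⟨h, -⟩
      · obtain ⟨a, b⟩ := hG.injective e.1 e'.1 x x' h0 h1 h0' h1' h
        exact ⟨Subtype.ext a, b⟩
      · exact (hAc e.1 e.2 x h0 h1 h).elim
    · exact fun e => ⟨_, hG.zero_mem e.1, rfl⟩
    · exact fun e => ⟨_, hG.one_mem e.1, rfl⟩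
    · intro e s hs hs'
      have := (hopen (G.ι e.1 '' s) (hG.isOpen_image e.1 s hs hs') (Or.inl (by
        rw [Set.eq_empty_iff_forall_notMem]
        rintro _ ⟨⟨y, hy, rfl⟩, hyA⟩
        exact hAc e.1 e.2 y (hs' hy).1 (hs' hy).2 hyA))).1
      rwa [Set.image_image] at this
    · rintro _ ⟨v, hv, rfl⟩ _ ⟨v', hv', rfl⟩ hne
      exact (hne (Quotient.sound (Or.inr ⟨Or.inl hv, Or.inl hv'⟩))).elim
    · refine ⟨fun c c' hne => ?_⟩
      induction c using Quotient.inductionOn with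
      | h p =>
      induction c' using Quotient.inductionOn with
      | h q =>
        rcases hcases p with hp | ⟨e, he, x, h0, h1, rfl⟩ <;>
          rcases hcases q with hq | ⟨f, hf, y, h0', h1', rfl⟩
        · exact (hne (Quotient.sound (Or.inr ⟨hp, hq⟩))).elim
        · obtain ⟨U, U', a, b, c, d, hd⟩ := sep f hf y h0' h1' p hp
          exact ⟨U', U, b, a, d, c, hd.symm⟩
        · exact sep e he x h0 h1 q hq
        · have hpq : G.ι e x ≠ G.ι f y := fun h => hne (congrArg _ h)
          obtain ⟨U, U', hU, hU', hx, hy, hd⟩ := t2_separation hpq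
          have hI : ∀ g, g ∉ F → G.ι g '' Set.Ioo 0 1 ∩ A = ∅ := by
            intro g hg
            rw [Set.eq_empty_iff_forall_notMem]
            rintro _ ⟨⟨z, hz, rfl⟩, hzA⟩
            exact hAc g hg z hz.1 hz.2 hzA
          obtain ⟨o1, s1⟩ := hopen (U ∩ G.ι e '' Set.Ioo 0 1)
            (hU.inter (hG.isOpen_image e _ isOpen_Ioo subset_rfl))
            (Or.inl (by rw [Set.inter_assoc, hI e he, Set.inter_empty]))
          obtain ⟨o2, s2⟩ := hopen (U' ∩ G.ι f '' Set.Ioo 0 1)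
            (hU'.inter (hG.isOpen_image f _ isOpen_Ioo subset_rfl))
            (Or.inl (by rw [Set.inter_assoc, hI f hf, Set.inter_empty]))
          refine ⟨_, _, o1, o2, ⟨_, ⟨hx, ⟨x, ⟨h0, h1⟩, rfl⟩⟩, rfl⟩,
            ⟨_, ⟨hy, ⟨y, ⟨h0', h1'⟩, rfl⟩⟩, rfl⟩, ?_⟩
          rw [Set.disjoint_left]
          rintro c hc hc'
          induction c using Quotient.inductionOn with
          | h p =>
            have hp1 : p ∈ U ∩ G.ι e '' Set.Ioo 0 1 := by rw [← s1]; exact hc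
            have hp2 : p ∈ U' ∩ G.ι f '' Set.Ioo 0 1 := by rw [← s2]; exact hc'
            exact Set.disjoint_left.1 hd hp1.1 hp2.1

theorem isContracting_contractionRel (G : GraphLikeSpace) (F : Set G.Edge) :
    G.IsContracting F (G.contractionRel F) := by
  have hG := G.isGraphLike
  obtain ⟨r₀, hr₀⟩ := G.exists_isContracting F
  have hF : ∀ e ∈ F, ∀ x y, G.contractionRel F (G.ι e x) (G.ι e y) :=
    fun e he x y r hr => hr.1 e he x y
  -- the canonical maps to the quotients by larger relations
  let π : ∀ r, G.IsContracting F r → Quotient (G.contractionRel F) → Quotient r :=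
    fun r hr => Quotient.map' id (fun a b hab => hab r hr)
  have hπ : ∀ r hr, Continuous (π r hr) := fun r hr =>
    continuous_quotient_mk'.quotient_lift _
  have hne : ∀ p q, ¬ G.contractionRel F p q → ∃ r, G.IsContracting F r ∧ ¬ r p q := by
    intro p q h
    rw [contractionRel_iff] at h
    push Not at h
    exact h
  refine ⟨hF, ?_, ?_, ?_, ?_, ?_, ?_, ?_, ?_⟩
  · intro e
    exact continuous_quotient_mk'.comp (hG.continuous e.1)
  · intro c
    constructor
    · intro hc
      induction c using Quotient.inductionOn with
      | h p =>
        rcases hG.mem_cases p with hp | ⟨e, x, h0, h1, rfl⟩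
        · exact (hc ⟨p, hp, rfl⟩).elim
        · by_cases he : e ∈ F
          · exact (hc ⟨G.ι e 0, hG.zero_mem e, Quotient.sound (hF e he 0 x)⟩).elim
          · exact ⟨⟨e, he⟩, x, h0, h1, rfl⟩
    · rintro ⟨e, x, h0, h1, rfl⟩ ⟨v, hv, hvx⟩
      refine hr₀.2.inner_notMem (e := e) h0 h1 ⟨v, hv, Quotient.sound ?_⟩
      exact (Quotient.exact hvx : G.contractionRel F _ _) r₀ hr₀
  · intro e e' x x' h0 h1 h0' h1' heq
    exact hr₀.2.injective e e' x x' h0 h1 h0' h1'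
      (Quotient.sound ((Quotient.exact heq : G.contractionRel F _ _) r₀ hr₀))
  · exact fun e => ⟨_, hG.zero_mem e.1, rfl⟩
  · exact fun e => ⟨_, hG.one_mem e.1, rfl⟩
  · intro e s hs hs'
    rw [← isQuotientMap_quotient_mk'.isOpen_preimage]
    convert hG.isOpen_image e.1 s hs hs' using 1
    ext p
    constructor
    · rintro ⟨x, hx, hxp⟩
      have h : G.contractionRel F (G.ι e.1 x) p := Quotient.exact hxp
      exact ⟨x, hx, (hr₀.eq_of_rel e.2 (hs' hx).1 (hs' hx).2 (h r₀ hr₀)).symm⟩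
    · rintro ⟨x, hx, rfl⟩
      exact ⟨x, hx, rfl⟩
  · rintro _ ⟨v, hv, rfl⟩ _ ⟨v', hv', rfl⟩ hvv
    obtain ⟨r, hr, hvr⟩ := hne v v' (fun h => hvv (Quotient.sound h))
    obtain ⟨U, U', hU, hU', hd, hc, h1, h2⟩ := hr.2.separated _ ⟨v, hv, rfl⟩ _ ⟨v', hv', rfl⟩
      (fun h => hvr (Quotient.exact h))
    refine ⟨π r hr ⁻¹' U, π r hr ⁻¹' U', hU.preimage (hπ r hr), hU'.preimage (hπ r hr),
      hd.preimage _, ?_, h1, h2⟩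
    rintro _ ⟨w, hw, rfl⟩
    exact hc ⟨w, hw, rfl⟩
  · refine ⟨fun c c' hcc => ?_⟩
    induction c using Quotient.inductionOn with
    | h p =>
    induction c' using Quotient.inductionOn with
    | h q =>
      obtain ⟨r, hr, hpq⟩ := hne p q (fun h => hcc (Quotient.sound h))
      have := hr.2.hausdorff
      obtain ⟨U, U', hU, hU', hx, hy, hd⟩ :=
        t2_separation (fun h => hpq (Quotient.exact h) : Quotient.mk r p ≠ Quotient.mk r q)
      exact ⟨π r hr ⁻¹' U, π r hr ⁻¹' U', hU.preimage (hπ r hr), hU'.preimage (hπ r hr), hx, hy,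
        hd.preimage _⟩

/-- The contraction `G/F` of `F` in `G`. -/
def contract (G : GraphLikeSpace) (F : Set G.Edge) : GraphLikeSpace where
  Point := Quotient (G.contractionRel F)
  Edge := {e : G.Edge // e ∉ F}
  vertexSet := Quotient.mk (G.contractionRel F) '' G.vertexSet
  ι := G.quotientι F (G.contractionRel F)
  isGraphLike := (G.isContracting_contractionRel F).2

/-- The contraction `G.F = G/(E(G) \ F)` to `F` in `G`. -/
def contractTo (G : GraphLikeSpace) (F : Set G.Edge) : GraphLikeSpace := G.contract Fᶜ

/-- The sub-graph-like space `G - F` for a set `F` of edges. -/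
def deleteEdges (G : GraphLikeSpace) (F : Set G.Edge) : GraphLikeSpace where
  Point := {p : G.Point | ¬ ∃ e ∈ F, ∃ x, 0 < x ∧ x < 1 ∧ G.ι e x = p}
  Edge := {e : G.Edge // e ∉ F}
  vertexSet := Subtype.val ⁻¹' G.vertexSet
  ι := fun e x => ⟨G.ι e.1 x, by
    rintro ⟨f, hf, y, h0, h1, h⟩
    have hv : ∀ v ∈ G.vertexSet, G.ι f y ≠ v :=
      fun v hv hh => G.isGraphLike.inner_notMem h0 h1 (hh ▸ hv)
    rcases eq_or_lt_of_le (show 0 ≤ x from x.2.1) with rfl | hx0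
    · exact hv _ (G.isGraphLike.zero_mem _) h
    rcases eq_or_lt_of_le (show x ≤ 1 from x.2.2) with rfl | hx1
    · exact hv _ (G.isGraphLike.one_mem _) h
    exact e.2 ((G.isGraphLike.injective f e.1 y x h0 h1 hx0 hx1 h).1 ▸ hf)⟩
  isGraphLike := G.isGraphLike.restrict _ Subtype.val Subtype.val_injective _
    (fun e x h0 h1 h => ⟨⟨e, fun he => h ⟨e, he, x, h0, h1, rfl⟩⟩, rfl⟩)

/-- `W` is a set of vertices none of which is an end-vertex of an edge. -/
def IsNonEndVertexSet (G : GraphLikeSpace) (W : Set G.Point) : Prop :=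
  W ⊆ G.vertexSet ∧ ∀ e, G.ι e 0 ∉ W ∧ G.ι e 1 ∉ W

/-- The sub-graph-like space `G - W` for a set `W` of non-end-vertices. -/
def deleteVertices (G : GraphLikeSpace) (W : Set G.Point) (hW : G.IsNonEndVertexSet W) :
    GraphLikeSpace where
  Point := (Wᶜ : Set G.Point)
  Edge := G.Edge
  vertexSet := Subtype.val ⁻¹' G.vertexSet
  ι := fun e x => ⟨G.ι e x, by
    intro h
    rcases eq_or_lt_of_le (show 0 ≤ x from x.2.1) with rfl | hx0
    · exact (hW.2 e).1 h
    rcases eq_or_lt_of_le (show x ≤ 1 from x.2.2) with rfl | hx1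
    · exact (hW.2 e).2 h
    exact G.isGraphLike.inner_notMem hx0 hx1 (hW.1 h)⟩
  isGraphLike := G.isGraphLike.restrict _ id Function.injective_id _ (fun e _ _ _ _ => ⟨e, rfl⟩)

/-- Isomorphism of graph-like spaces: there is a homeomorphism that induces a bijection between the
vertex sets. -/
def IsIsomorphic (G H : GraphLikeSpace) : Prop :=
  ∃ φ : G.Point ≃ₜ H.Point, Set.BijOn φ G.vertexSet H.vertexSet

/-- `G'` is a minor of `G`: it is isomorphic to `((G/F₁) - F₂) - W` for disjoint sets `F₁`, `F₂` of
edges of `G` and a set `W` of non-end-vertices of `(G/F₁) - F₂`. -/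
def IsMinor (G' G : GraphLikeSpace) : Prop :=
  ∃ F₁ F₂ : Set G.Edge, Disjoint F₁ F₂ ∧
    ∃ (W : Set ((G.contract F₁).deleteEdges {e | e.1 ∈ F₂}).Point)
      (hW : ((G.contract F₁).deleteEdges {e | e.1 ∈ F₂}).IsNonEndVertexSet W),
      G'.IsIsomorphic (((G.contract F₁).deleteEdges {e | e.1 ∈ F₂}).deleteVertices W hW)

end GraphLikeSpace

/-! ### The tree-like space of a regular tree set -/

namespace SeparationSystem

variable {α : Type*} [SeparationSystem α]

/-- The ground set of `T(τ)`: the consistent orientations of `τ` (its vertices) and the pairs of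
an unoriented separation of `τ` and a number strictly between `0` and `1`. -/
inductive TreePoint (τ : Set α)
  | vertex (O : ConsistentOrientation τ)
  | inner (e : UnorientedSep τ) (x : Set.Ioo (0 : ℝ) 1)

/-- The sub-basic set `S(e, r)` for an oriented separation `e`, where the edges are directed by the
orientation `D` of `τ`: it consists of the vertices `O` with `e ∈ O`, the inner points of the edges
with an orientation greater than `e`, and the part of the edge of `e` beyond `r`, in the direction
of `e`. -/
def subbasic (τ D : Set α) (e : α) (r : ℝ) : Set (TreePoint τ) :=
  {p | match p with
    | .vertex O => e ∈ O.1
    | .inner f x => (∃ s ∈ f.1, e < s) ∨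
        (e ∈ f.1 ∧ ((e ∈ D ∧ r < x) ∨ (e ∉ D ∧ (x : ℝ) < r)))}

/-- The topology of `T(τ)`. -/
abbrev treeTopology (τ D : Set α) : TopologicalSpace (TreePoint τ) :=
  TopologicalSpace.generateFrom {S | ∃ e ∈ τ, ∃ r ∈ Set.Ioo (0 : ℝ) 1, S = subbasic τ D e r}

theorem existsUnique_orientation {τ D : Set α} (hD : IsOrientation τ D) (e : UnorientedSep τ) :
    ∃! s, s ∈ D ∧ s ∈ e.1 := by
  obtain ⟨s, hs, he⟩ := e.2
  rw [he]
  exact hD.existsUnique s hs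

/-- The orientation of the unoriented separation `e` that lies in the orientation `D` of `τ`. -/
noncomputable def orient {τ D : Set α} (hD : IsOrientation τ D) (e : UnorientedSep τ) : α :=
  (existsUnique_orientation hD e).choose

theorem orient_mem {τ D : Set α} (hD : IsOrientation τ D) (e : UnorientedSep τ) :
    orient hD e ∈ D := (existsUnique_orientation hD e).choose_spec.1.1

theorem orient_mem_edge {τ D : Set α} (hD : IsOrientation τ D) (e : UnorientedSep τ) :
    orient hD e ∈ e.1 := (existsUnique_orientation hD e).choose_spec.1.2

theorem orient_mem_tree {τ D : Set α} (hD : IsOrientation τ D) (e : UnorientedSep τ) :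
    orient hD e ∈ τ := hD.subset (orient_mem hD e)

theorem coe_eq_unoriented {τ : Set α} (e : UnorientedSep τ) {s : α} (hs : s ∈ e.1) :
    e.1 = unoriented s := by
  obtain ⟨t, ht, he⟩ := e.2
  rw [he] at hs ⊢
  exact (unoriented_eq_iff.2 hs).symm

/-- The map `ι_e`: it runs from the orientation in which the inverse of `s` is maximal to the one in
which `s` is maximal, where `s` is the orientation of `e` chosen in `D`. -/
noncomputable def treeι {τ D : Set α} (hτ : IsRegularTreeSet τ) (hD : IsOrientation τ D)
    (e : UnorientedSep τ) (x : unitInterval) : TreePoint τ :=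
  open Classical in
  if h : 0 < x ∧ x < 1 then .inner e ⟨x.1, h.1, h.2⟩
  else if x = 0 then
    .vertex (maxOrientation hτ (inv (orient hD e)) (hτ.inv_mem _ (orient_mem_tree hD e)))
  else .vertex (maxOrientation hτ (orient hD e) (orient_mem_tree hD e))

section

open scoped Topology

variable {τ D : Set α}

theorem treeι_inner (hτ : IsRegularTreeSet τ) (hD : IsOrientation τ D)
    (e : UnorientedSep τ) {x : unitInterval} (h0 : 0 < x) (h1 : x < 1) :
    treeι hτ hD e x = .inner e ⟨x.1, h0, h1⟩ := by
  simp [treeι, h0, h1]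

theorem treeι_zero (hτ : IsRegularTreeSet τ) (hD : IsOrientation τ D)
    (e : UnorientedSep τ) : treeι hτ hD e 0 =
    .vertex (maxOrientation hτ (inv (orient hD e)) (hτ.inv_mem _ (orient_mem_tree hD e))) := by
  simp [treeι]

theorem treeι_one (hτ : IsRegularTreeSet τ) (hD : IsOrientation τ D)
    (e : UnorientedSep τ) :
    treeι hτ hD e 1 = .vertex (maxOrientation hτ (orient hD e) (orient_mem_tree hD e)) := by
  simp [treeι]

theorem isOpen_subbasic {e : α} (he : e ∈ τ) {r : ℝ} (hr : r ∈ Set.Ioo (0 : ℝ) 1) :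
    IsOpen[treeTopology τ D] (subbasic τ D e r) :=
  TopologicalSpace.isOpen_generateFrom_of_mem ⟨e, he, r, hr, rfl⟩

theorem disjoint_subbasic (hτ : IsRegularTreeSet τ) (hD : IsOrientation τ D)
    {e : α} (he : e ∈ D) {a b : ℝ} (hab : b ≤ a) :
    Disjoint (subbasic τ D e a) (subbasic τ D (inv e) b) := by
  have heτ := hD.subset he
  have hne : inv e ∉ D := fun h => hD.not_both hτ he h
  rw [Set.disjoint_left]
  rintro (O | ⟨f, x⟩) h1 h2
  · exact O.2.1.not_both hτ h1 h2
  · have small : ∀ s ∈ f.1, e < s → ∀ t ∈ f.1, inv e < t → False := by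
      intro s hs hes t ht het
      rw [coe_eq_unoriented f hs] at ht
      have hsτ : s ∈ τ := by
        obtain ⟨u, hu, hfu⟩ := f.2
        rw [hfu] at hs
        rcases hs with rfl | rfl
        · exact hu
        · exact hτ.inv_mem _ hu
      rcases ht with rfl | rfl
      · exact hτ.not_inv_le hsτ ((inv_lt_iff.1 het).le.trans hes.le)
      · exact absurd hes (inv_lt_inv_iff.1 het).not_gt
    rcases h1 with ⟨s, hs, hes⟩ | ⟨hef, h1⟩
    · rcases h2 with ⟨t, ht, het⟩ | ⟨hef, -⟩
      · exact small s hs hes t ht het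
      · rw [coe_eq_unoriented f hef] at hs
        rcases hs with rfl | rfl
        · exact hτ.not_le_inv heτ hes.le
        · rw [inv_inv] at hes
          exact lt_irrefl _ hes
    · rcases h2 with ⟨t, ht, het⟩ | ⟨-, h2⟩
      · rw [coe_eq_unoriented f hef] at ht
        rcases ht with rfl | rfl
        · exact hτ.not_inv_le heτ het.le
        · exact lt_irrefl _ het
      · rcases h1 with ⟨-, h1⟩ | ⟨h1, -⟩
        · rcases h2 with ⟨h2, -⟩ | ⟨-, h2⟩
          · exact hne h2
          · linarith
        · exact h1 he

theorem isOpen_inner (hτ : IsRegularTreeSet τ) (hD : IsOrientation τ D)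
    (f : UnorientedSep τ) {a b : ℝ} (ha : a ∈ Set.Ioo (0 : ℝ) 1)
    (hb : b ∈ Set.Ioo (0 : ℝ) 1) :
    IsOpen[treeTopology τ D] {p | ∃ x : Set.Ioo (0 : ℝ) 1, a < x ∧ x < b ∧ p = .inner f x} := by
  let _ := treeTopology τ D
  have he := orient_mem hD f
  have heτ := orient_mem_tree hD f
  have hef := orient_mem_edge hD f
  have hne : inv (orient hD f) ∉ D := fun h => hD.not_both hτ he h
  have hef' : inv (orient hD f) ∈ f.1 := by
    rw [coe_eq_unoriented f hef]; exact Or.inr rfl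
  convert (isOpen_subbasic (D := D) heτ ha).inter
    (isOpen_subbasic (D := D) (hτ.inv_mem _ heτ) hb) using 1
  ext p
  constructor
  · rintro ⟨x, h1, h2, rfl⟩
    exact ⟨Or.inr ⟨hef, Or.inl ⟨he, h1⟩⟩, Or.inr ⟨hef', Or.inr ⟨hne, h2⟩⟩⟩
  · rintro ⟨h1, h2⟩
    rcases p with O | ⟨g, x⟩
    · exact (O.2.1.not_both hτ h1 h2).elim
    · have hx : g = f ∧ a < x ∧ x < b := by
        by_cases hg : orient hD f ∈ g.1
        · have hgf : g = f := Subtype.ext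
            ((coe_eq_unoriented g hg).trans (coe_eq_unoriented f hef).symm)
          subst hgf
          refine ⟨rfl, ?_, ?_⟩
          · rcases h1 with ⟨s, hs, hes⟩ | ⟨-, ⟨-, h⟩ | ⟨h, -⟩⟩
            · rw [coe_eq_unoriented g hg] at hs
              rcases hs with rfl | hs
              · exact (lt_irrefl _ hes).elim
              · exact (hτ.not_le_inv heτ (hs ▸ hes.le)).elim
            · exact h
            · exact (h he).elim
          · rcases h2 with ⟨s, hs, hes⟩ | ⟨-, ⟨h, -⟩ | ⟨-, h⟩⟩
            · rw [coe_eq_unoriented g hg] at hs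
              rcases hs with hs | hs
              · exact (hτ.not_inv_le heτ (hs ▸ hes.le)).elim
              · exact (lt_irrefl _ (hs ▸ hes)).elim
            · exact (hne h).elim
            · exact h
        · exfalso
          have hg' : inv (orient hD f) ∉ g.1 := by
            intro h
            apply hg
            rw [coe_eq_unoriented g h]
            exact Or.inr (inv_inv _).symm
          refine Set.disjoint_left.1 (disjoint_subbasic hτ hD he (le_refl (a : ℝ)))
            (show TreePoint.inner g x ∈ _ from h1) ?_
          rcases h2 with h2 | ⟨h2, -⟩
          · exact Or.inl h2
          · exact (hg' h2).elim
      obtain ⟨rfl, h⟩ := hx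
      exact ⟨x, h.1, h.2, rfl⟩

theorem continuous_treeι (hτ : IsRegularTreeSet τ) (hD : IsOrientation τ D)
    (f : UnorientedSep τ) :
    Continuous[_, treeTopology τ D] (treeι hτ hD f) := by
  let _ := treeTopology τ D
  refine continuous_generateFrom_iff.2 ?_
  rintro _ ⟨e, he, r, hr, rfl⟩
  have hs := orient_mem hD f
  have hsτ := orient_mem_tree hD f
  have hsf := orient_mem_edge hD f
  have hns : inv (orient hD f) ∉ D := fun h => hD.not_both hτ hs h
  have hfe := coe_eq_unoriented f hsf
  have cases3 : ∀ x : unitInterval, x = 0 ∨ x = 1 ∨ (0 < x ∧ x < 1) := by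
    intro x
    rcases eq_or_lt_of_le (show 0 ≤ x from x.2.1) with h | h
    · exact Or.inl h.symm
    rcases eq_or_lt_of_le (show x ≤ 1 from x.2.2) with h' | h'
    · exact Or.inr (Or.inl h')
    · exact Or.inr (Or.inr ⟨h, h'⟩)
  generalize hgs : orient hD f = s at *
  have m0 : treeι hτ hD f 0 ∈ subbasic τ D e r ↔ (e ≤ inv s ∨ e < s) := by
    rw [treeι_zero]
    subst hgs
    refine (mem_maxOrientation hτ (hτ.inv_mem _ hsτ)).trans ?_
    rw [inv_inv]
    exact and_iff_right he
  have m1 : treeι hτ hD f 1 ∈ subbasic τ D e r ↔ (e ≤ s ∨ e < inv s) := by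
    rw [treeι_one]
    subst hgs
    exact (mem_maxOrientation hτ hsτ).trans (and_iff_right he)
  have mi : ∀ x, 0 < x → x < 1 → (treeι hτ hD f x ∈ subbasic τ D e r ↔
      ((e < s ∨ e < inv s) ∨
        ((e = s ∨ e = inv s) ∧ ((e ∈ D ∧ r < x) ∨ (e ∉ D ∧ (x : ℝ) < r))))) := by
    intro x h0 h1
    rw [treeι_inner hτ hD f h0 h1]
    change ((∃ t ∈ f.1, e < t) ∨ (e ∈ f.1 ∧ _)) ↔ _
    rw [hfe]
    simp [unoriented]
  by_cases h1 : e = s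
  · subst h1
    have : treeι hτ hD f ⁻¹' subbasic τ D e r = {x : unitInterval | r < x} := by
      ext x
      simp only [Set.mem_preimage, Set.mem_ofPred_eq]
      rcases cases3 x with rfl | rfl | ⟨h0, h1⟩
      · rw [m0]
        have := hr.1.le
        simp [hτ.not_le_inv hsτ, this]
      · rw [m1]
        have := hr.2
        simp [this]
      · rw [mi x h0 h1]
        have : ¬ e < inv e := fun h => hτ.not_le_inv hsτ h.le
        simp [hs, this]
    rw [this]
    exact isOpen_lt continuous_const continuous_subtype_val
  by_cases h2 : e = inv s
  · subst h2
    have : treeι hτ hD f ⁻¹' subbasic τ D (inv s) r = {x : unitInterval | (x : ℝ) < r} := by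
      ext x
      simp only [Set.mem_preimage, Set.mem_ofPred_eq]
      rcases cases3 x with rfl | rfl | ⟨h0, h1⟩
      · rw [m0]
        have := hr.1
        simp [this]
      · rw [m1]
        have := hr.2.le
        simp [hτ.not_inv_le hsτ, this]
      · rw [mi x h0 h1]
        have : ¬ inv s < s := fun h => hτ.not_inv_le hsτ h.le
        simp [hns, this]
    rw [this]
    exact isOpen_lt continuous_subtype_val continuous_const
  · have key : ∀ x, treeι hτ hD f x ∈ subbasic τ D e r ↔ (e < s ∨ e < inv s) := by
      intro x
      rcases cases3 x with rfl | rfl | ⟨h0, h1'⟩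
      · rw [m0, le_iff_lt_or_eq]
        simp only [h2, or_false]
        exact or_comm
      · rw [m1, le_iff_lt_or_eq]
        simp only [h1, or_false]
      · rw [mi x h0 h1']
        simp [h1, h2]
    by_cases h : e < s ∨ e < inv s
    · convert isOpen_univ
      ext x
      simpa using (key x).2 h
    · convert isOpen_empty
      ext x
      simpa using fun hx => h ((key x).1 hx)

/-- Two points separated by the two sides of an edge. -/
theorem sides_separate (hτ : IsRegularTreeSet τ) (hD : IsOrientation τ D)
    {e : α} (he : e ∈ D) {r : ℝ} (hr : r ∈ Set.Ioo (0 : ℝ) 1) :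
    ∃ U U' : Set (TreePoint τ), IsOpen[treeTopology τ D] U ∧ IsOpen[treeTopology τ D] U' ∧
      Disjoint U U' ∧ Set.range TreePoint.vertex ⊆ U ∪ U' ∧
      U = subbasic τ D e r ∧ U' = subbasic τ D (inv e) r := by
  refine ⟨_, _, isOpen_subbasic (hD.subset he) hr,
    isOpen_subbasic (hτ.inv_mem _ (hD.subset he)) hr, disjoint_subbasic hτ hD he le_rfl, ?_,
    rfl, rfl⟩
  rintro _ ⟨O, rfl⟩
  exact O.2.1.mem_or (hD.subset he)

theorem isGraphLike_tree (hτ : IsRegularTreeSet τ) (hD : IsOrientation τ D) :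
    @IsGraphLike _ _ (treeTopology τ D) (Set.range TreePoint.vertex) (treeι hτ hD) := by
  let _ := treeTopology τ D
  have half : (1 / 2 : ℝ) ∈ Set.Ioo (0 : ℝ) 1 := by norm_num
  have sepV : ∀ O O' : ConsistentOrientation τ, O ≠ O' → ∃ U U' : Set (TreePoint τ),
      IsOpen U ∧ IsOpen U' ∧ Disjoint U U' ∧ Set.range TreePoint.vertex ⊆ U ∪ U' ∧
        TreePoint.vertex O ∈ U ∧ TreePoint.vertex O' ∈ U' := by
    intro O O' hne
    have : ∃ e ∈ D, ¬ (e ∈ O.1 ↔ e ∈ O'.1) := by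
      by_contra hcon
      push Not at hcon
      apply hne
      apply Subtype.ext
      ext s
      by_cases hs : s ∈ τ
      · rcases hD.mem_or hs with h | h
        · exact hcon s h
        · have := hcon _ h
          rw [O.2.1.inv_mem_iff hτ hs, O'.2.1.inv_mem_iff hτ hs] at this
          exact not_iff_not.1 this
      · exact ⟨fun h => (hs (O.2.1.subset h)).elim, fun h => (hs (O'.2.1.subset h)).elim⟩
    obtain ⟨e, he, hee⟩ := this
    have heτ := hD.subset he
    obtain ⟨U, U', hU, hU', hd, hc, rfl, rfl⟩ := sides_separate hτ hD he half
    by_cases h : e ∈ O.1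
    · refine ⟨_, _, hU, hU', hd, hc, h, (O'.2.1.inv_mem_iff hτ heτ).2 (fun h' => hee ?_)⟩
      exact ⟨fun _ => h', fun _ => h⟩
    · refine ⟨_, _, hU', hU, hd.symm, by rwa [Set.union_comm], (O.2.1.inv_mem_iff hτ heτ).2 h, ?_⟩
      by_contra h'
      exact hee ⟨fun hh => (h hh).elim, fun hh => (h' hh).elim⟩
  have sepI : ∀ (O : ConsistentOrientation τ) (f : UnorientedSep τ) (x : Set.Ioo (0 : ℝ) 1),
      ∃ U U' : Set (TreePoint τ), IsOpen U ∧ IsOpen U' ∧ TreePoint.vertex O ∈ U ∧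
        TreePoint.inner f x ∈ U' ∧ Disjoint U U' := by
    intro O f x
    have hs := orient_mem hD f
    have hsf := orient_mem_edge hD f
    have hns : inv (orient hD f) ∉ D := fun h => hD.not_both hτ hs h
    have hsf' : inv (orient hD f) ∈ f.1 := by
      rw [coe_eq_unoriented f hsf]; exact Or.inr rfl
    rcases O.2.1.mem_or (hD.subset hs) with h | h
    · obtain ⟨r, hr1, hr2⟩ := exists_between x.2.2
      obtain ⟨U, U', hU, hU', hd, hc, rfl, rfl⟩ :=
        sides_separate hτ hD hs (r := r) ⟨x.2.1.trans hr1, hr2⟩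
      exact ⟨_, _, hU, hU', h, Or.inr ⟨hsf', Or.inr ⟨hns, hr1⟩⟩, hd⟩
    · obtain ⟨r, hr1, hr2⟩ := exists_between x.2.1
      obtain ⟨U, U', hU, hU', hd, hc, rfl, rfl⟩ :=
        sides_separate hτ hD hs (r := r) ⟨hr1, hr2.trans x.2.2⟩
      exact ⟨_, _, hU', hU, h, Or.inr ⟨hsf, Or.inl ⟨hs, hr2⟩⟩, hd.symm⟩
  refine ⟨continuous_treeι hτ hD, ?_, ?_, ?_, ?_, ?_, ?_, ?_⟩
  · rintro (O | ⟨f, x⟩)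
    · constructor
      · intro h
        exact (h ⟨O, rfl⟩).elim
      · rintro ⟨e, x, h0, h1, h⟩
        rw [treeι_inner hτ hD e h0 h1] at h
        cases h
    · constructor
      · intro _
        exact ⟨f, ⟨x.1, x.2.1.le, x.2.2.le⟩, x.2.1, x.2.2, treeι_inner hτ hD f x.2.1 x.2.2⟩
      · rintro - ⟨O, hO⟩
        cases hO
  · intro e e' x x' h0 h1 h0' h1' h
    rw [treeι_inner hτ hD e h0 h1, treeι_inner hτ hD e' h0' h1'] at h
    simp only [TreePoint.inner.injEq] at h
    exact ⟨h.1, Subtype.ext (congrArg (fun z : Set.Ioo (0 : ℝ) 1 => (z : ℝ)) h.2)⟩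
  · intro e
    rw [treeι_zero]
    exact ⟨_, rfl⟩
  · intro e
    rw [treeι_one]
    exact ⟨_, rfl⟩
  · intro e s hs hs'
    rw [isOpen_iff_forall_mem_open]
    rintro _ ⟨x, hx, rfl⟩
    obtain ⟨a, b, hab, hsub⟩ := (mem_nhds_iff_exists_Ioo_subset' (a := x)
      ⟨0, (hs' hx).1⟩ ⟨1, (hs' hx).2⟩).1 (hs.mem_nhds hx)
    obtain ⟨a', ha', hax⟩ := exists_between (max_lt hab.1 (hs' hx).1)
    obtain ⟨b', hbx, hb'⟩ := exists_between (lt_min hab.2 (hs' hx).2)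
    have hxa : a' < x := hax
    have ha0 : 0 < a' := (le_max_right _ _).trans_lt ha'
    have hb1 : b' < 1 := hb'.trans_le (min_le_right _ _)
    refine ⟨_, ?_, isOpen_inner hτ hD e (a := a') (b := b') ⟨ha0, hxa.trans (hs' hx).2⟩
      ⟨(hs' hx).1.trans hbx, hb1⟩, ?_⟩
    · rintro _ ⟨y, h1, h2, rfl⟩
      refine ⟨⟨y.1, y.2.1.le, y.2.2.le⟩, hsub ⟨?_, ?_⟩, treeι_inner hτ hD e y.2.1 y.2.2⟩
      · exact ((le_max_left a 0).trans_lt ha').trans h1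
      · exact lt_trans (show (_ : unitInterval) < b' from h2) (hb'.trans_le (min_le_left b 1))
    · rw [treeι_inner hτ hD e (hs' hx).1 (hs' hx).2]
      exact ⟨_, hax, hbx, rfl⟩
  · rintro _ ⟨O, rfl⟩ _ ⟨O', rfl⟩ hne
    exact sepV O O' (fun h => hne (congrArg _ h))
  · refine ⟨?_⟩
    rintro (O | ⟨f, x⟩) (O' | ⟨g, y⟩) hne
    · obtain ⟨U, U', a, b, hd, -, c, d⟩ := sepV O O' (fun h => hne (congrArg _ h))
      exact ⟨U, U', a, b, c, d, hd⟩
    · exact sepI O g y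
    · obtain ⟨U, U', a, b, c, d, hd⟩ := sepI O' f x
      exact ⟨U', U, b, a, d, c, hd.symm⟩
    · obtain ⟨a, ha0, hax⟩ := exists_between x.2.1
      obtain ⟨b, hxb, hb1⟩ := exists_between x.2.2
      obtain ⟨a', ha0', hax'⟩ := exists_between y.2.1
      obtain ⟨b', hxb', hb1'⟩ := exists_between y.2.2
      by_cases hfg : f = g
      · subst hfg
        have hxy : (x : ℝ) ≠ y := fun h => hne (congrArg _ (Subtype.ext h))
        rcases lt_or_gt_of_ne hxy with h | h
        · obtain ⟨m, h1, h2⟩ := exists_between h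
          have hm : m ∈ Set.Ioo (0 : ℝ) 1 := ⟨x.2.1.trans h1, h2.trans y.2.2⟩
          refine ⟨_, _, isOpen_inner hτ hD f ⟨ha0, hax.trans x.2.2⟩ hm,
            isOpen_inner hτ hD f hm ⟨y.2.1.trans hxb', hb1'⟩, ⟨x, hax, h1, rfl⟩,
            ⟨y, h2, hxb', rfl⟩, ?_⟩
          rw [Set.disjoint_left]
          rintro _ ⟨z, h3, h4, rfl⟩ ⟨z', h5, h6, h7⟩
          cases h7
          exact lt_asymm h4 h5
        · obtain ⟨m, h1, h2⟩ := exists_between h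
          have hm : m ∈ Set.Ioo (0 : ℝ) 1 := ⟨y.2.1.trans h1, h2.trans x.2.2⟩
          refine ⟨_, _, isOpen_inner hτ hD f hm ⟨x.2.1.trans hxb, hb1⟩,
            isOpen_inner hτ hD f ⟨ha0', hax'.trans y.2.2⟩ hm, ⟨x, h2, hxb, rfl⟩,
            ⟨y, hax', h1, rfl⟩, ?_⟩
          rw [Set.disjoint_left]
          rintro _ ⟨z, h3, h4, rfl⟩ ⟨z', h5, h6, h7⟩
          cases h7
          exact lt_asymm h3 h6
      · refine ⟨_, _, isOpen_inner hτ hD f ⟨ha0, hax.trans x.2.2⟩ ⟨x.2.1.trans hxb, hb1⟩,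
          isOpen_inner hτ hD g ⟨ha0', hax'.trans y.2.2⟩ ⟨y.2.1.trans hxb', hb1'⟩,
          ⟨x, hax, hxb, rfl⟩, ⟨y, hax', hxb', rfl⟩, ?_⟩
        rw [Set.disjoint_left]
        rintro _ ⟨z, h3, h4, rfl⟩ ⟨z', h5, h6, h7⟩
        cases h7
        exact hfg rfl

/-- The space `T(τ)` of a regular tree set `τ`, where the edges are directed by the orientation `D`
of `τ`. -/
noncomputable def treeLikeSpace (hτ : IsRegularTreeSet τ) (hD : IsOrientation τ D) :
    GraphLikeSpace where
  Point := TreePoint τ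
  Edge := UnorientedSep τ
  topology := treeTopology τ D
  vertexSet := Set.range TreePoint.vertex
  ι := treeι hτ hD
  isGraphLike := isGraphLike_tree hτ hD

end

/-- The unoriented separations of `τ₁`, as a subset of those of `τ₂`. -/
def edgesOf (τ₁ τ₂ : Set α) : Set (UnorientedSep τ₂) := {e | ∃ s ∈ τ₁, e.1 = unoriented s}

end SeparationSystem

/-! Record a point of T(τ) by its coordinates: the number in [0,1] at `s` says how far the point
lies on the side of `s`. A vertex O has coordinate 1 on O and 0 elsewhere; a point on the edge of
`s` has a fractional value only at `s` and `inv s`. The functions arising in this way are those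
described by `IsCoord`, which are cut out of a cube by closed conditions. The topology of T(τ) is
the one induced by the coordinates (`isEmbedding_coord`, `range_coord`), so T(τ) is compact.

For τ₁ ⊆ τ₂, forgetting the coordinates outside τ₁ gives a continuous map T(τ₂) → T(τ₁). It is onto
because coordinate functions extend (`IsCoord.exists_indicator_eq`), and hence a quotient map, its
domain being compact and its target Hausdorff. It collapses the edges outside τ₁ and keeps the
others, so its kernel is one of the relations among which the contraction takes the smallest.

The kernel is also below every such relation. Over an inner point of an edge the fibre is a single
point. Over a vertex the fibre is connected (`isPreconnected_setOf_isCoord`), and all its points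
become vertices in any admissible quotient. Since distinct vertices of a graph-like space are
separated by disjoint open sets covering all vertices, a connected fibre must become one vertex.
Hence the contraction relation is the kernel, and its quotient is T(τ₁). -/

namespace SeparationSystem

/-! ### Coordinate functions of a tree set -/

section Coordinates

open Set

variable {α : Type*} [SeparationSystem α] {τ : Set α}

/-- The coordinate functions of the points of `T(τ)`: the value at `s` measures how far a point
lies on the side of `s`. -/
structure IsCoord (τ : Set α) (f : α → ℝ) : Prop where
  mem_Icc : ∀ s, f s ∈ Icc (0 : ℝ) 1
  eq_zero : ∀ s ∉ τ, f s = 0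
  add_inv : ∀ s ∈ τ, f s + f (inv s) = 1
  -- For 0-1 values this is consistency: an orientation containing `t` contains everything in τ
  -- below `t`. As a disjunction of equations it is a closed condition, and it also allows
  -- fractional values.
  lt : ∀ s ∈ τ, ∀ t ∈ τ, s < t → f s = 1 ∨ f t = 0

open Classical in
/-- The coordinate function of the point at `x` on the edge of `s`, directed towards `s`. -/
noncomputable def edgeCoord (τ : Set α) (s : α) (x : ℝ) (t : α) : ℝ :=
  if t = s then x else if t = inv s then 1 - x else
    if t ∈ τ ∧ (t < s ∨ t < inv s) then 1 else 0

theorem IsRegularTreeSet.ne_inv (hτ : IsRegularTreeSet τ) {s : α} (hs : s ∈ τ) : s ≠ inv s :=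
  fun h => hτ.not_le_inv hs h.le

theorem edgeCoord_self (s : α) (x : ℝ) : edgeCoord τ s x s = x := by simp [edgeCoord]

theorem edgeCoord_inv (hτ : IsRegularTreeSet τ) {s : α} (hs : s ∈ τ) (x : ℝ) :
    edgeCoord τ s x (inv s) = 1 - x := by
  simp [edgeCoord, (hτ.ne_inv hs).symm]

theorem edgeCoord_of_lt (hτ : IsRegularTreeSet τ) {s t : α} (hs : s ∈ τ) (ht : t ∈ τ)
    (h : t < s ∨ t < inv s) (x : ℝ) : edgeCoord τ s x t = 1 := by
  have h1 : t ≠ s := by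
    rintro rfl
    exact h.elim (lt_irrefl _) fun h => hτ.not_le_inv hs h.le
  have h2 : t ≠ inv s := by
    rintro rfl
    exact h.elim (fun h => hτ.not_inv_le hs h.le) (lt_irrefl _)
  simp [edgeCoord, h1, h2, ht, h]

theorem edgeCoord_of_gt (hτ : IsRegularTreeSet τ) {s t : α} (hs : s ∈ τ) (ht : t ∈ τ)
    (h : s < t ∨ inv s < t) (x : ℝ) : edgeCoord τ s x t = 0 := by
  have h1 : t ≠ s := by
    rintro rfl
    exact h.elim (lt_irrefl _) fun h => hτ.not_inv_le hs h.le
  have h2 : t ≠ inv s := by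
    rintro rfl
    exact h.elim (fun h => hτ.not_le_inv hs h.le) (lt_irrefl _)
  have h3 : ¬ (t < s ∨ t < inv s) := by
    rintro (h' | h') <;> rcases h with h | h
    · exact lt_asymm h h'
    · exact hτ.not_inv_le hs (h.trans h').le
    · exact hτ.not_le_inv hs (h.trans h').le
    · exact lt_asymm h h'
  simp [edgeCoord, h1, h2, h3]

theorem edgeCoord_of_notMem (hτ : IsRegularTreeSet τ) {s t : α} (hs : s ∈ τ) (ht : t ∉ τ)
    (x : ℝ) : edgeCoord τ s x t = 0 := by
  have h1 : t ≠ s := fun h => ht (h ▸ hs)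
  have h2 : t ≠ inv s := fun h => ht (h ▸ hτ.inv_mem s hs)
  simp [edgeCoord, h1, h2, ht]

theorem IsRegularTreeSet.trichotomy (hτ : IsRegularTreeSet τ) {s t : α} (hs : s ∈ τ)
    (ht : t ∈ τ) :
    t = s ∨ t = inv s ∨ (t < s ∨ t < inv s) ∨ (s < t ∨ inv s < t) := by
  rcases hτ.compare ht hs with h | h | h | h <;> rcases h.eq_or_lt with h | h <;> simp [h]

/-- Traversing an edge from its other end replaces x by 1 - x. This reduces the end at 0 to the end
at 1. -/
theorem edgeCoord_inv_eq (hτ : IsRegularTreeSet τ) {s : α} (hs : s ∈ τ) (x : ℝ) :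
    edgeCoord τ (inv s) (1 - x) = edgeCoord τ s x := by
  funext t
  have hs' := hτ.inv_mem s hs
  by_cases ht : t ∈ τ
  · rcases hτ.trichotomy hs ht with rfl | rfl | h | h
    · have := edgeCoord_inv hτ hs' (1 - x)
      rw [inv_inv] at this
      rw [this, edgeCoord_self]; ring
    · rw [edgeCoord_self, edgeCoord_inv hτ hs]
    · rw [edgeCoord_of_lt hτ hs ht h, edgeCoord_of_lt hτ hs' ht (by rwa [inv_inv, or_comm])]
    · rw [edgeCoord_of_gt hτ hs ht h, edgeCoord_of_gt hτ hs' ht (by rwa [inv_inv, or_comm])]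
  · rw [edgeCoord_of_notMem hτ hs ht, edgeCoord_of_notMem hτ hs' ht]

theorem IsCoord.inv_eq {f : α → ℝ} (hf : IsCoord τ f) {s : α} (hs : s ∈ τ) :
    f (inv s) = 1 - f s := by linarith [hf.add_inv s hs]

/-- A fractional value at `s` excludes the second alternative of `lt` at `s` and, since the value at
`inv s` is then fractional too, also at `inv s`. -/
theorem IsCoord.eq_one_of_lt (hτ : IsRegularTreeSet τ) {f : α → ℝ} (hf : IsCoord τ f) {s t : α}
    (hs : s ∈ τ) (ht : t ∈ τ) (h0 : f s ≠ 0) (h1 : f s ≠ 1) (h : t < s ∨ t < inv s) :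
    f t = 1 := by
  rcases h with h | h
  · exact (hf.lt t ht s hs h).resolve_right h0
  · refine (hf.lt t ht _ (hτ.inv_mem s hs) h).resolve_right ?_
    rw [hf.inv_eq hs]
    exact fun h => h1 (by linarith)

theorem IsCoord.eq_zero_of_gt (hτ : IsRegularTreeSet τ) {f : α → ℝ} (hf : IsCoord τ f) {s t : α}
    (hs : s ∈ τ) (ht : t ∈ τ) (h0 : f s ≠ 0) (h1 : f s ≠ 1) (h : s < t ∨ inv s < t) :
    f t = 0 := by
  have := hf.eq_one_of_lt hτ hs (hτ.inv_mem t ht) h0 h1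
    (by rw [inv_lt_iff, inv_lt_inv_iff, or_comm]; exact h)
  rw [hf.inv_eq ht] at this
  linarith

/-- A coordinate function that is not integral at `s` belongs to an inner point of an edge. -/
theorem IsCoord.eq_edgeCoord (hτ : IsRegularTreeSet τ) {f : α → ℝ} (hf : IsCoord τ f) {s : α}
    (hs : s ∈ τ) (h0 : f s ≠ 0) (h1 : f s ≠ 1) : f = edgeCoord τ s (f s) := by
  funext t
  by_cases ht : t ∈ τ
  · rcases hτ.trichotomy hs ht with rfl | rfl | h | h
    · rw [edgeCoord_self]
    · rw [edgeCoord_inv hτ hs, hf.inv_eq hs]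
    · rw [edgeCoord_of_lt hτ hs ht h, hf.eq_one_of_lt hτ hs ht h0 h1 h]
    · rw [edgeCoord_of_gt hτ hs ht h, hf.eq_zero_of_gt hτ hs ht h0 h1 h]
  · rw [edgeCoord_of_notMem hτ hs ht, hf.eq_zero t ht]

theorem isCoord_edgeCoord (hτ : IsRegularTreeSet τ) {s : α} (hs : s ∈ τ) {x : ℝ}
    (hx : x ∈ Icc (0 : ℝ) 1) : IsCoord τ (edgeCoord τ s x) where
  mem_Icc t := by
    unfold edgeCoord
    split_ifs
    · exact hx
    · exact ⟨by linarith [hx.2], by linarith [hx.1]⟩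
    · simp
    · simp
  eq_zero t ht := edgeCoord_of_notMem hτ hs ht x
  add_inv t ht := by
    have ht' := hτ.inv_mem t ht
    rcases hτ.trichotomy hs ht with rfl | rfl | h | h
    · rw [edgeCoord_self, edgeCoord_inv hτ hs]; ring
    · rw [inv_inv, edgeCoord_self, edgeCoord_inv hτ hs]; ring
    · rw [edgeCoord_of_lt hτ hs ht h, edgeCoord_of_gt hτ hs ht'
        (by rw [lt_inv_iff, inv_lt_inv_iff, or_comm]; exact h)]; ring
    · rw [edgeCoord_of_gt hτ hs ht h, edgeCoord_of_lt hτ hs ht'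
        (by rw [inv_lt_iff, inv_lt_inv_iff, or_comm]; exact h)]; ring
  lt t ht u hu htu := by
    rcases hτ.trichotomy hs ht with rfl | rfl | h | h
    · exact Or.inr (edgeCoord_of_gt hτ hs hu (Or.inl htu) x)
    · exact Or.inr (edgeCoord_of_gt hτ hs hu (Or.inr htu) x)
    · exact Or.inl (edgeCoord_of_lt hτ hs ht h x)
    · exact Or.inr (edgeCoord_of_gt hτ hs hu (h.imp (fun h => h.trans htu) fun h => h.trans htu) x)

/-- Between two coordinate functions that differ at `s`, the edge of `s` lies on the way. -/
theorem IsCoord.edgeCoord_apply_eq (hτ : IsRegularTreeSet τ) {f g : α → ℝ} (hf : IsCoord τ f)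
    (hg : IsCoord τ g) {s t : α} (hs : s ∈ τ) (hfg : f s ≠ g s) (hfgt : f t = g t) :
    edgeCoord τ s (g s) t = g t := by
  by_contra hne
  by_cases ht : t ∈ τ
  · have key : ∀ u ∈ τ, ∀ v ∈ τ, u < v → f v ≠ g v → f u = g u → g u = 1 := by
      intro u hu v hv huv hv' hu'
      by_contra h1
      have hg0 := (hg.lt u hu v hv huv).resolve_left h1
      have hf0 := (hf.lt u hu v hv huv).resolve_left (hu' ▸ h1)
      exact hv' (hf0.trans hg0.symm)
    have hs' := hτ.inv_mem s hs
    have ht' := hτ.inv_mem t ht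
    have hfg' : f (inv s) ≠ g (inv s) := by
      rw [hf.inv_eq hs, hg.inv_eq hs]
      exact fun h => hfg (by linarith)
    have hfgt' : f (inv t) = g (inv t) := by rw [hf.inv_eq ht, hg.inv_eq ht, hfgt]
    rcases hτ.trichotomy hs ht with rfl | rfl | h | h
    · exact hfg hfgt
    · exact hfg' hfgt
    · rw [edgeCoord_of_lt hτ hs ht h] at hne
      rcases h with h | h
      · exact hne (key t ht s hs h hfg hfgt).symm
      · exact hne (key t ht _ hs' h hfg' hfgt).symm
    · rw [edgeCoord_of_gt hτ hs ht h] at hne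
      have : g (inv t) = 1 := by
        rcases h with h | h
        · exact key _ ht' _ hs' (inv_lt_inv_iff.2 h) hfg' hfgt'
        · exact key _ ht' s hs (inv_lt_iff.1 h) hfg hfgt'
      rw [hg.inv_eq ht] at this
      exact hne (by linarith)
  · exact hne (by rw [edgeCoord_of_notMem hτ hs ht, hg.eq_zero t ht])

/-! ### Compactness and connectedness of sets of coordinate functions -/

theorem continuous_edgeCoord (s : α) : Continuous (edgeCoord τ s) := by
  refine continuous_pi fun t => ?_
  unfold edgeCoord
  split_ifs <;> fun_prop

/-- Each axiom is a closed condition on at most two coordinates. -/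
theorem isClosed_setOf_isCoord : IsClosed {f : α → ℝ | IsCoord τ f} := by
  have : {f : α → ℝ | IsCoord τ f} = (⋂ s, {f | f s ∈ Icc (0 : ℝ) 1}) ∩
      ((⋂ s ∈ τᶜ, {f | f s = 0}) ∩ ((⋂ s ∈ τ, {f | f s + f (inv s) = 1}) ∩
        ⋂ s ∈ τ, ⋂ t ∈ τ, ⋂ _ : s < t, ({f | f s = 1} ∪ {f | f t = 0}))) := by
    ext f
    simp only [mem_ofPred_eq, mem_inter_iff, mem_iInter, mem_union]
    exact ⟨fun h => ⟨h.1, h.2, h.3, h.4⟩, fun h => ⟨h.1, h.2.1, h.2.2.1, h.2.2.2⟩⟩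
  rw [this]
  have hc : ∀ s : α, Continuous fun f : α → ℝ => f s := continuous_apply
  refine (isClosed_iInter fun s => isClosed_Icc.preimage (hc s)).inter (IsClosed.inter ?_
    (IsClosed.inter ?_ ?_))
  · exact isClosed_biInter fun s _ => isClosed_eq (hc s) continuous_const
  · exact isClosed_biInter fun s _ => isClosed_eq ((hc s).add (hc _)) continuous_const
  · refine isClosed_biInter fun s _ => isClosed_biInter fun t _ => isClosed_iInter fun _ => ?_
    exact (isClosed_eq (hc s) continuous_const).union (isClosed_eq (hc t) continuous_const)

theorem isCompact_setOf_isCoord : IsCompact {f : α → ℝ | IsCoord τ f} :=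
  (isCompact_univ_pi fun _ : α => isCompact_Icc (a := (0 : ℝ)) (b := 1)).of_isClosed_subset
    isClosed_setOf_isCoord fun _ hf s _ => hf.mem_Icc s

/-- The coordinate functions with given values on a set of separations form a connected set. -/
theorem isPreconnected_setOf_isCoord (hτ : IsRegularTreeSet τ) (σ : Set α) (c : α → ℝ) :
    IsPreconnected {f : α → ℝ | IsCoord τ f ∧ ∀ t ∈ σ, f t = c t} := by
  set K := {f : α → ℝ | IsCoord τ f ∧ ∀ t ∈ σ, f t = c t} with hK
  have hKc : IsCompact K := by
    refine isCompact_setOf_isCoord.inter_right (t := {f | ∀ t ∈ σ, f t = c t}) ?_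
    simp only [ofPred_forall]
    exact isClosed_biInter fun s _ => isClosed_eq (continuous_apply s) continuous_const
  rw [isPreconnected_closed_iff]
  rintro A B hA hB hAB ⟨f₀, hf₀⟩ ⟨g₀, hg₀⟩
  by_contra hcon
  have hdisj : ∀ f ∈ K, f ∈ A → f ∈ B → False := fun f h1 h2 h3 => hcon ⟨f, h1, h2, h3⟩
  -- Given a separation of `K` into `A` and `B`, choose `f` in `A` and `g` in `B` whose set of
  -- differences is minimal, and join them nearer to each other along an edge on which they differ.
  let d : (α → ℝ) × (α → ℝ) → Set α := fun p => {s | p.1 s ≠ p.2 s}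
  let P := (K ∩ A) ×ˢ (K ∩ B)
  have hPc : IsCompact P := (hKc.inter_right hA).prod (hKc.inter_right hB)
  obtain ⟨m, hm⟩ := zorn_superset (d '' P) (by
    intro C hC hchain
    rcases C.eq_empty_or_nonempty with rfl | hne
    · exact ⟨_, ⟨(f₀, g₀), ⟨hf₀, hg₀⟩, rfl⟩, by simp⟩
    -- Agreement outside `S` is a closed condition, so by compactness of `P` a chain of difference
    -- sets has a pair whose difference set lies in all of them.
    have hcl : ∀ S : Set α, IsClosed {p : (α → ℝ) × (α → ℝ) | d p ⊆ S} := by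
      intro S
      have : {p : (α → ℝ) × (α → ℝ) | d p ⊆ S} = ⋂ s ∈ Sᶜ, {p | p.1 s = p.2 s} := by
        ext p
        simp only [d, mem_ofPred_eq, mem_iInter, mem_compl_iff]
        exact ⟨fun h s hs => by_contra fun h' => hs (h h'),
          fun h s hs => by_contra fun h' => hs (h s h')⟩
      rw [this]
      exact isClosed_biInter fun s _ => isClosed_eq
        ((continuous_apply s).comp continuous_fst) ((continuous_apply s).comp continuous_snd)
    have := hne.to_subtype
    obtain ⟨p, hp⟩ := IsCompact.nonempty_iInter_of_directed_nonempty_isCompact_isClosed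
      (fun S : C => P ∩ {p | d p ⊆ S.1})
      (by
        intro S T
        rcases hchain.total S.2 T.2 with h | h
        · exact ⟨S, subset_rfl, fun p hp => ⟨hp.1, hp.2.trans h⟩⟩
        · exact ⟨T, fun p hp => ⟨hp.1, hp.2.trans h⟩, subset_rfl⟩)
      (by
        rintro ⟨S, hS⟩
        obtain ⟨p, hp, rfl⟩ := hC hS
        exact ⟨p, hp, subset_refl (d p)⟩)
      (fun S => hPc.inter_right (hcl _))
      (fun S => hPc.isClosed.inter (hcl _))
    rw [mem_iInter] at hp
    exact ⟨d p, ⟨p, (hp ⟨_, hne.some_mem⟩).1, rfl⟩, fun S hS => (hp ⟨S, hS⟩).2⟩)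
  obtain ⟨⟨⟨f, g⟩, ⟨⟨hfK, hfA⟩, hgK, hgB⟩, rfl⟩, hmin⟩ := hm
  obtain ⟨s, hs⟩ : ∃ s, f s ≠ g s := by
    by_contra h
    push Not at h
    exact hdisj f hfK hfA ((funext h : f = g) ▸ hgB)
  have hsτ : s ∈ τ := by
    by_contra h
    exact hs ((hfK.1.eq_zero s h).trans (hgK.1.eq_zero s h).symm)
  -- Both functions take the prescribed values on `σ`, so they cannot differ there.
  have hs' : ∀ t ∈ σ, t ≠ s ∧ t ≠ inv s := by
    refine fun t ht => ⟨?_, ?_⟩ <;> rintro rfl <;>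
      have := (hfK.2 _ ht).trans (hgK.2 _ ht).symm
    · exact hs this
    · rw [hfK.1.inv_eq hsτ, hgK.1.inv_eq hsτ] at this
      exact hs (by linarith)
  -- The whole edge of `s` satisfies the constraints: off `s` and `inv s` its coordinates do not
  -- depend on `x`, and where `f` and `g` agree they equal the common value.
  have hEK : ∀ x ∈ Icc (0 : ℝ) 1, edgeCoord τ s x ∈ K := by
    refine fun x hx => ⟨isCoord_edgeCoord hτ hsτ hx, fun t ht => ?_⟩
    have h1 := hfK.1.edgeCoord_apply_eq hτ hgK.1 hsτ hs ((hfK.2 t ht).trans (hgK.2 t ht).symm)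
    rw [← hgK.2 t ht, ← h1]
    simp [edgeCoord, hs' t ht]
  have hgx := hEK _ (hgK.1.mem_Icc s)
  have hfx := hEK _ (hfK.1.mem_Icc s)
  -- Were this point in `A`, it could replace `f`: it differs from `g` only where `f` does, and no
  -- longer at `s`, against minimality. Symmetrically for `f` below.
  have h1 : edgeCoord τ s (g s) ∈ B := by
    refine (hAB hgx).resolve_left fun h => ?_
    have := hmin (y := d (edgeCoord τ s (g s), g))
      ⟨(edgeCoord τ s (g s), g), ⟨⟨hgx, h⟩, hgK, hgB⟩, rfl⟩
      (fun t ht h => ht (hfK.1.edgeCoord_apply_eq hτ hgK.1 hsτ hs h)) hs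
    exact this (edgeCoord_self s _)
  have h2 : edgeCoord τ s (f s) ∈ A := by
    refine (hAB hfx).resolve_right fun h => ?_
    have := hmin (y := d (f, edgeCoord τ s (f s)))
      ⟨(f, edgeCoord τ s (f s)), ⟨⟨hfK, hfA⟩, hfx, h⟩, rfl⟩
      (fun t ht h => ht (hgK.1.edgeCoord_apply_eq hτ hfK.1 hsτ hs.symm h.symm).symm) hs
    exact this (edgeCoord_self s _).symm
  -- The edge is connected, lies in `K` and meets both `A` and `B`, so it meets their intersection.
  have hE : IsPreconnected (edgeCoord τ s '' Icc 0 1) :=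
    isPreconnected_Icc.image _ (continuous_edgeCoord s).continuousOn
  rw [isPreconnected_closed_iff] at hE
  obtain ⟨_, ⟨x, hx, rfl⟩, hxA, hxB⟩ := hE A B hA hB
    (by rintro _ ⟨x, hx, rfl⟩; exact hAB (hEK x hx))
    ⟨_, ⟨_, hfK.1.mem_Icc s, rfl⟩, h2⟩ ⟨_, ⟨_, hgK.1.mem_Icc s, rfl⟩, h1⟩
  exact hdisj _ (hEK x hx) hxA hxB

/-! ### Restriction and extension of coordinate functions -/

theorem IsCoord.indicator {τ₁ τ₂ : Set α} (h₁ : IsRegularTreeSet τ₁) (hsub : τ₁ ⊆ τ₂)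
    {f : α → ℝ} (hf : IsCoord τ₂ f) : IsCoord τ₁ (τ₁.indicator f) where
  mem_Icc s := by
    by_cases h : s ∈ τ₁
    · simpa [h] using hf.mem_Icc s
    · simp [h]
  eq_zero s h := indicator_of_notMem h f
  add_inv s h := by
    rw [indicator_of_mem h, indicator_of_mem (h₁.inv_mem s h), hf.add_inv s (hsub h)]
  lt s hs t ht hst := by
    rw [indicator_of_mem hs, indicator_of_mem ht]
    exact hf.lt s (hsub hs) t (hsub ht) hst

theorem indicator_edgeCoord {τ₁ τ₂ : Set α} (h₁ : IsRegularTreeSet τ₁) (hsub : τ₁ ⊆ τ₂) {s : α}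
    (hs : s ∈ τ₁) (x : ℝ) : τ₁.indicator (edgeCoord τ₂ s x) = edgeCoord τ₁ s x := by
  funext t
  by_cases ht : t ∈ τ₁
  · rw [indicator_of_mem ht]
    have := hsub ht
    unfold edgeCoord
    split_ifs <;> tauto
  · rw [indicator_of_notMem ht, edgeCoord_of_notMem h₁ hs ht]

/-- The position `x` is visible only at `s` and `inv s`, both outside `τ₁`. This is why restriction
collapses the edge. -/
theorem indicator_edgeCoord_of_notMem {τ₁ : Set α} (h₁ : IsRegularTreeSet τ₁) {s : α}
    (hs : s ∉ τ₁) (x y : ℝ) :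
    τ₁.indicator (edgeCoord τ s x) = τ₁.indicator (edgeCoord τ s y) := by
  funext t
  by_cases ht : t ∈ τ₁
  · rw [indicator_of_mem ht, indicator_of_mem ht]
    have h1 : t ≠ s := fun h => hs (h ▸ ht)
    have h2 : t ≠ inv s := fun h => hs (by rw [← inv_inv s, ← h]; exact h₁.inv_mem t ht)
    simp [edgeCoord, h1, h2]
  · rw [indicator_of_notMem ht, indicator_of_notMem ht]

/-- Provides values for the separations that an extension problem leaves undecided. -/
theorem exists_isCoord (hτ : IsRegularTreeSet τ) : ∃ f, IsCoord τ f := by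
  rcases τ.eq_empty_or_nonempty with rfl | ⟨s, hs⟩
  · exact ⟨0, by simp, by simp, by simp, by simp⟩
  · exact ⟨_, isCoord_edgeCoord hτ hs (x := 0) (by simp)⟩

/-- Coordinate functions extend to larger tree sets. -/
theorem IsCoord.exists_indicator_eq {τ₁ τ₂ : Set α} (h₁ : IsRegularTreeSet τ₁)
    (h₂ : IsRegularTreeSet τ₂) (hsub : τ₁ ⊆ τ₂) {f : α → ℝ} (hf : IsCoord τ₁ f) :
    ∃ g, IsCoord τ₂ g ∧ τ₁.indicator g = f := by
  classical
  by_cases hint : ∃ s ∈ τ₁, f s ≠ 0 ∧ f s ≠ 1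
  · obtain ⟨s, hs, h0, h1⟩ := hint
    refine ⟨_, isCoord_edgeCoord h₂ (hsub hs) (hf.mem_Icc s), ?_⟩
    rw [indicator_edgeCoord h₁ hsub hs]
    exact (hf.eq_edgeCoord h₁ hs h0 h1).symm
  push Not at hint
  obtain ⟨h, hh⟩ := exists_isCoord h₂
  -- `L` is the down-closure in `τ₂` of the orientation given by `f`, where consistency forces the
  -- value 1. The extension is 1 on `L`, 0 on the inverses of `L`, and an arbitrary coordinate
  -- function `h` elsewhere.
  let L : α → Prop := fun s => s ∈ τ₂ ∧ ∃ t ∈ τ₁, f t = 1 ∧ s ≤ t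
  -- If `s ≤ t` and `inv s ≤ u`, then `inv u ≤ t`, while `f` is 0 at `inv u` and 1 at `t`.
  have hL : ∀ s, L s → ¬ L (inv s) := by
    rintro s ⟨hs, t, ht, hft, hst⟩ ⟨-, u, hu, hfu, hsu⟩
    have hu' : f (inv u) = 0 := by rw [hf.inv_eq hu, hfu, sub_self]
    rcases ((inv_le_iff.1 hsu).trans hst).eq_or_lt with h | h
    · rw [h, hft] at hu'
      exact one_ne_zero hu'
    · rcases hf.lt _ (h₁.inv_mem u hu) t ht h with h | h
      · exact one_ne_zero (h.symm.trans hu')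
      · exact one_ne_zero (hft.symm.trans h)
  have hmono : ∀ s ∈ τ₂, ∀ t, s ≤ t → L t → L s := by
    rintro s hs t hst ⟨-, u, hu, hfu, htu⟩
    exact ⟨hs, u, hu, hfu, hst.trans htu⟩
  refine ⟨fun s => if L s then 1 else if L (inv s) then 0 else h s, ⟨?_, ?_, ?_, ?_⟩, ?_⟩
  · intro s
    split_ifs
    · simp
    · simp
    · exact hh.mem_Icc s
  · intro s hs
    have hs1 : ¬ L s := fun h => hs h.1
    simp [hs1, hh.eq_zero s hs]
  · intro s hs
    rw [inv_inv]
    by_cases h1 : L s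
    · simp [h1, hL s h1]
    · by_cases h2 : L (inv s)
      · simp [h1, h2]
      · simp [h1, h2, hh.add_inv s hs]
  · intro s hs t ht hst
    by_cases h1 : L s
    · simp [h1]
    · have h2 : ¬ L t := fun h => h1 (hmono s hs t hst.le h)
      by_cases h3 : L (inv t)
      · simp [h2, h3]
      -- Since `L` is closed downwards, both `s` and `t` are now undecided, and the condition is
      -- inherited from `h`.
      · have h4 : ¬ L (inv s) := fun h => h3 (hmono _ (h₂.inv_mem t ht) _ (inv_le_inv hst.le) h)
        simpa [h1, h2, h3, h4] using hh.lt s hs t ht hst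
  · funext s
    by_cases hs : s ∈ τ₁
    · rw [indicator_of_mem hs]
      by_cases h0 : f s = 0
      · have h1 : L (inv s) := ⟨hsub (h₁.inv_mem s hs), inv s, h₁.inv_mem s hs,
          by rw [hf.inv_eq hs, h0, sub_zero], le_rfl⟩
        have h2 : ¬ L s := fun h => hL s h h1
        simp [h1, h2, h0]
      · have h1 := hint s hs h0
        have : L s := ⟨hsub hs, s, hs, h1, le_rfl⟩
        simp [this, h1]
    · rw [indicator_of_notMem hs, hf.eq_zero s hs]

end Coordinates

/-! ### T(τ) as the compact space of coordinate functions -/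

section TreePoints

open Set
open scoped Topology

variable {α : Type*} [SeparationSystem α] {τ D : Set α}

open Classical in
/-- The coordinate function of a point of `T(τ)`. -/
noncomputable def coord (hD : IsOrientation τ D) : TreePoint τ → α → ℝ
  | .vertex O => O.1.indicator 1
  | .inner e x => edgeCoord τ (orient hD e) x

theorem isCoord_coord (hτ : IsRegularTreeSet τ) (hD : IsOrientation τ D) (p : TreePoint τ) :
    IsCoord τ (coord hD p) := by
  rcases p with O | ⟨e, x⟩
  · refine ⟨fun s => ?_, fun s hs => ?_, fun s hs => ?_, fun s hs t ht hst => ?_⟩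
    · by_cases h : s ∈ O.1 <;> simp [coord, h]
    · exact indicator_of_notMem (fun h => hs (O.2.1.subset h)) _
    · have := O.2.1.inv_mem_iff hτ hs
      by_cases h : s ∈ O.1
      · simp [coord, h, this]
      · simp [coord, h, this]
    · by_cases hsO : s ∈ O.1
      · simp [coord, hsO]
      by_cases htO : t ∈ O.1
      -- Here `inv s` and `t` both lie in the orientation although `s < t`, which consistency
      -- forbids.
      · have hs' := (O.2.1.inv_mem_iff hτ hs).2 hsO
        rcases unoriented_eq_iff.1 (O.2.2 t htO _ hs' (by rw [inv_inv]; exact hst.le))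
          with rfl | h
        · exact (hτ.not_le_inv hs hst.le).elim
        · rw [inv_inv] at h
          exact (hst.ne h.symm).elim
      · simp [coord, htO]
  · exact isCoord_edgeCoord hτ (orient_mem_tree hD e) ⟨x.2.1.le, x.2.2.le⟩

/-- The end-vertex of an edge obeys the formula for its inner points at x = 1, so an edge with its
ends is a single path in coordinates. -/
theorem coord_maxOrientation (hτ : IsRegularTreeSet τ) (hD : IsOrientation τ D) {s : α}
    (hs : s ∈ τ) : coord hD (.vertex (maxOrientation hτ s hs)) = edgeCoord τ s 1 := by
  funext t
  have key := mem_maxOrientation hτ hs (r := t)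
  by_cases ht : t ∈ τ
  · rcases hτ.trichotomy hs ht with rfl | rfl | h | h
    · simp [coord, edgeCoord_self, key, ht]
    · simp [coord, edgeCoord_inv hτ hs, key, hτ.not_inv_le hs]
    · have h' : t ≤ s ∨ t < inv s := h.imp_left le_of_lt
      rw [edgeCoord_of_lt hτ hs ht h]
      simp [coord, key, ht, h']
    · have h' : ¬ (t ≤ s ∨ t < inv s) := by
        rintro (h' | h') <;> rcases h with h | h
        · exact h.not_ge h'
        · exact hτ.not_inv_le hs (h.le.trans h')
        · exact hτ.not_le_inv hs (h.trans h').le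
        · exact lt_asymm h h'
      rw [edgeCoord_of_gt hτ hs ht h]
      simp [coord, key, h']
  · rw [edgeCoord_of_notMem hτ hs ht]
    simp [coord, key, ht]

theorem coord_treeι (hτ : IsRegularTreeSet τ) (hD : IsOrientation τ D) (e : UnorientedSep τ)
    (x : unitInterval) : coord hD (treeι hτ hD e x) = edgeCoord τ (orient hD e) x := by
  rcases eq_or_lt_of_le (show 0 ≤ x from x.2.1) with rfl | h0
  · rw [treeι_zero, coord_maxOrientation, ← edgeCoord_inv_eq hτ (orient_mem_tree hD e)]
    simp
  rcases eq_or_lt_of_le (show x ≤ 1 from x.2.2) with rfl | h1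
  · rw [treeι_one, coord_maxOrientation]
    simp
  · rw [treeι_inner hτ hD e h0 h1]
    rfl

theorem coord_inner_orient (hD : IsOrientation τ D) (e : UnorientedSep τ) (x : Ioo (0 : ℝ) 1) :
    coord hD (.inner e x) (orient hD e) = x := edgeCoord_self _ _

theorem coord_vertex_eq (hD : IsOrientation τ D) (O : ConsistentOrientation τ) (s : α) :
    coord hD (.vertex O) s = 0 ∨ coord hD (.vertex O) s = 1 := by
  by_cases h : s ∈ O.1 <;> simp [coord, h]

theorem orient_eq_of_mem (hD : IsOrientation τ D) {e : UnorientedSep τ} {s : α} (hs : s ∈ D)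
    (hse : s ∈ e.1) : orient hD e = s :=
  (existsUnique_orientation hD e).unique ⟨orient_mem hD e, orient_mem_edge hD e⟩ ⟨hs, hse⟩

/-- The points where some coordinate is not integral are the inner points of edges. -/
theorem mem_range_vertex_iff (hD : IsOrientation τ D) (p : TreePoint τ) :
    p ∈ range TreePoint.vertex ↔ ∀ s, coord hD p s = 0 ∨ coord hD p s = 1 := by
  rcases p with O | ⟨e, x⟩
  · exact ⟨fun _ => coord_vertex_eq hD O, fun _ => ⟨O, rfl⟩⟩
  · refine ⟨nofun, fun h => ?_⟩
    have := h (orient hD e)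
    rw [coord_inner_orient] at this
    exact (this.elim x.2.1.ne' x.2.2.ne).elim

/-- Integrality tells vertices from inner points. An inner point is fractional only at the two
orientations of its edge, just one of which lies in `D`; the value there is its position. -/
theorem coord_injective (hτ : IsRegularTreeSet τ) (hD : IsOrientation τ D) :
    Function.Injective (coord hD) := by
  intro p q hpq
  have hv : p ∈ range TreePoint.vertex ↔ q ∈ range TreePoint.vertex := by
    rw [mem_range_vertex_iff hD, mem_range_vertex_iff hD, hpq]
  rcases p with O | ⟨e, x⟩ <;> rcases q with O' | ⟨f, y⟩
  · congr 1
    refine Subtype.ext (Set.ext fun s => ?_)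
    have := congrFun hpq s
    by_cases h : s ∈ O.1 <;> by_cases h' : s ∈ O'.1 <;> simp [coord, h, h'] at this ⊢
  · obtain ⟨O', h⟩ := hv.1 ⟨O, rfl⟩
    cases h
  · obtain ⟨O, h⟩ := hv.2 ⟨O', rfl⟩
    cases h
  · have h := congrFun hpq (orient hD e)
    rw [coord_inner_orient] at h
    have he := orient_mem_tree hD e
    have hf := orient_mem_tree hD f
    have hef : orient hD e = orient hD f := by
      change (x : ℝ) = edgeCoord τ (orient hD f) y (orient hD e) at h
      rcases hτ.trichotomy hf he with h' | h' | h' | h'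
      · exact h'
      · exact (hD.not_both hτ (orient_mem hD f) (h' ▸ orient_mem hD e)).elim
      · rw [edgeCoord_of_lt hτ hf he h'] at h
        exact (x.2.2.ne h).elim
      · rw [edgeCoord_of_gt hτ hf he h'] at h
        exact (x.2.1.ne' h).elim
    have : e = f := Subtype.ext (by
      rw [coe_eq_unoriented e (orient_mem_edge hD e), coe_eq_unoriented f (orient_mem_edge hD f),
        hef])
    subst this
    rw [coord_inner_orient] at h
    rw [Subtype.ext h]

/-- A fractional value determines an edge and a position on it. Without fractional values, the
separations of value 1 form an orientation, consistent by `lt`. -/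
theorem IsCoord.exists_coord_eq (hτ : IsRegularTreeSet τ) (hD : IsOrientation τ D) {f : α → ℝ}
    (hf : IsCoord τ f) : ∃ p, coord hD p = f := by
  by_cases hint : ∃ s ∈ D, f s ≠ 0 ∧ f s ≠ 1
  · obtain ⟨s, hs, h0, h1⟩ := hint
    have hsτ := hD.subset hs
    obtain ⟨e, he⟩ : ∃ e : UnorientedSep τ, s ∈ e.1 := ⟨⟨_, s, hsτ, rfl⟩, Or.inl rfl⟩
    refine ⟨.inner e ⟨f s, (hf.mem_Icc s).1.lt_of_ne' h0, (hf.mem_Icc s).2.lt_of_ne h1⟩, ?_⟩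
    refine Eq.trans ?_ (hf.eq_edgeCoord hτ hsτ h0 h1).symm
    change edgeCoord τ (orient hD e) (f s) = _
    rw [orient_eq_of_mem hD hs he]
  have hint' : ∀ s, f s ≠ 1 → f s = 0 := by
    intro s h1
    by_contra h0
    have hsτ : s ∈ τ := by_contra fun h => h0 (hf.eq_zero s h)
    rcases hD.mem_or hsτ with h | h
    · exact hint ⟨s, h, h0, h1⟩
    · refine hint ⟨inv s, h, ?_⟩
      rw [hf.inv_eq hsτ]
      exact ⟨fun h => h1 (by linarith), fun h => h0 (by linarith)⟩
  have hmem : ∀ s, f s = 1 → s ∈ τ := fun s hs =>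
    by_contra fun h => one_ne_zero (hs.symm.trans (hf.eq_zero s h))
  refine ⟨.vertex ⟨{s | f s = 1}, ⟨hmem, fun s hs => ?_⟩, ?_⟩, ?_⟩
  · have hs' := hf.inv_eq hs
    by_cases h : f s = 1
    · refine ⟨s, ⟨h, Or.inl rfl⟩, ?_⟩
      rintro _ ⟨ht, rfl | rfl⟩
      · rfl
      · rw [mem_ofPred_eq, hs', h] at ht
        norm_num at ht
    · refine ⟨inv s, ⟨by rw [mem_ofPred_eq, hs', hint' s h, sub_zero], Or.inr rfl⟩, ?_⟩
      rintro _ ⟨ht, rfl | rfl⟩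
      · exact (h ht).elim
      · rfl
  · intro r hr s hs hsr
    have hsτ := hmem s hs
    have hs' : f (inv s) = 0 := by rw [hf.inv_eq hsτ, hs, sub_self]
    rw [unoriented_eq_iff]
    rcases hsr.eq_or_lt with h | h
    · exact Or.inr h.symm
    · rcases hf.lt _ (hτ.inv_mem s hsτ) r (hmem r hr) h with h | h
      · exact (one_ne_zero (h.symm.trans hs')).elim
      · exact (one_ne_zero (hr.symm.trans h)).elim
  · funext s
    by_cases h : f s = 1
    · simp [coord, h]
    · simp [coord, hint' s h]

theorem exists_mem_edge_lt_iff (hD : IsOrientation τ D)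
    (f : UnorientedSep τ) (s : α) :
    (∃ t ∈ f.1, s < t) ↔ s < orient hD f ∨ s < inv (orient hD f) := by
  rw [coe_eq_unoriented f (orient_mem_edge hD f)]
  simp [unoriented]

-- Subbasic sets are open half-spaces of single coordinates. The coordinate at `s` increases towards
-- `s`, whereas `r` is measured in the direction of `D`; this causes the threshold 1 - r for `s`
-- outside `D`.
open Classical in
theorem mem_subbasic_iff (hτ : IsRegularTreeSet τ) (hD : IsOrientation τ D) {s : α} (hs : s ∈ τ)
    {r : ℝ} (hr : r ∈ Ioo (0 : ℝ) 1) (p : TreePoint τ) :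
    p ∈ subbasic τ D s r ↔ (if s ∈ D then r else 1 - r) < coord hD p s := by
  have h0 : 0 < if s ∈ D then r else 1 - r := by split_ifs <;> linarith [hr.1, hr.2]
  have h1 : (if s ∈ D then r else 1 - r) < 1 := by split_ifs <;> linarith [hr.1, hr.2]
  rcases p with O | ⟨f, x⟩
  · change s ∈ O.1 ↔ _
    by_cases h : s ∈ O.1
    · simp [coord, h, h1]
    · simp [coord, h, h0.le]
  · have hf := orient_mem_tree hD f
    have hfD := orient_mem hD f
    have hfe := coe_eq_unoriented f (orient_mem_edge hD f)
    change ((∃ t ∈ f.1, s < t) ∨ (s ∈ f.1 ∧ _)) ↔ _ < edgeCoord τ (orient hD f) x s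
    rw [exists_mem_edge_lt_iff hD, hfe, mem_unoriented]
    generalize orient hD f = e at *
    have hns : inv e ∉ D := fun h => hD.not_both hτ hfD h
    rcases hτ.trichotomy hf hs with rfl | rfl | h | h
    · have : ¬ s < inv s := fun h => hτ.not_le_inv hs h.le
      simp [edgeCoord_self, hfD, this]
    · have : ¬ inv e < e := fun h => hτ.not_inv_le hf h.le
      simp only [edgeCoord_inv hτ hf, hns, this, if_false]
      simp
    · rw [edgeCoord_of_lt hτ hf hs h]
      simp only [h, true_or, h1]
    · have h2 : ¬ (s < e ∨ s < inv e) := by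
        rintro (h' | h') <;> rcases h with h | h
        · exact lt_asymm h h'
        · exact hτ.not_inv_le hf (h.trans h').le
        · exact hτ.not_le_inv hf (h.trans h').le
        · exact lt_asymm h h'
      have h3 : ¬ (s = e ∨ s = inv e) := by
        rintro (rfl | rfl) <;> rcases h with h | h
        · exact lt_irrefl _ h
        · exact hτ.not_inv_le hf h.le
        · exact hτ.not_le_inv hf h.le
        · exact lt_irrefl _ h
      rw [edgeCoord_of_gt hτ hf hs h]
      simp [h2, h3, h0.le]

theorem isOpen_setOf_lt_coord (hτ : IsRegularTreeSet τ) (hD : IsOrientation τ D) {s : α}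
    (hs : s ∈ τ) (a : ℝ) : IsOpen[treeTopology τ D] {p | a < coord hD p s} := by
  let _ := treeTopology τ D
  have key : ∀ b ∈ Ioo (0 : ℝ) 1, IsOpen {p | b < coord hD p s} := by
    intro b hb
    by_cases h : s ∈ D
    · convert isOpen_subbasic (D := D) hs hb using 1
      ext p
      rw [mem_subbasic_iff hτ hD hs hb, if_pos h]
      rfl
    · have hb' : 1 - b ∈ Ioo (0 : ℝ) 1 := ⟨by linarith [hb.2], by linarith [hb.1]⟩
      convert isOpen_subbasic (D := D) hs hb' using 1
      ext p
      rw [mem_subbasic_iff hτ hD hs hb', if_neg h, sub_sub_cancel]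
      rfl
  rcases lt_or_ge a 0 with ha | ha
  · convert isOpen_univ
    exact eq_univ_of_forall fun p => ha.trans_le ((isCoord_coord hτ hD p).mem_Icc s).1
  -- Subbasic sets only have thresholds strictly between 0 and 1. The union reaches a = 0, and is
  -- empty for a ≥ 1.
  · have : {p | a < coord hD p s} = ⋃ b ∈ {b : ℝ | b ∈ Ioo (0 : ℝ) 1 ∧ a ≤ b},
        {p | b < coord hD p s} := by
      ext p
      simp only [mem_ofPred_eq, mem_iUnion, exists_prop]
      constructor
      · intro h
        obtain ⟨b, h1, h2⟩ := exists_between h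
        exact ⟨b, ⟨⟨ha.trans_lt h1, h2.trans_le ((isCoord_coord hτ hD p).mem_Icc s).2⟩, h1.le⟩,
          h2⟩
      · rintro ⟨b, ⟨-, h1⟩, h2⟩
        exact h1.trans_lt h2
    rw [this]
    exact isOpen_biUnion fun b hb => key b hb.1

/-- Lower half-spaces at `s` are upper half-spaces at `inv s`, so the subbasic sets generate exactly
the topology induced from the product. -/
theorem isEmbedding_coord (hτ : IsRegularTreeSet τ) (hD : IsOrientation τ D) :
    @Topology.IsEmbedding _ _ (treeTopology τ D) _ (coord hD) := by
  let _ := treeTopology τ D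
  have hcont : Continuous (coord hD) := by
    refine continuous_pi fun s => ?_
    by_cases hs : s ∈ τ
    · rw [OrderTopology.continuous_iff]
      refine fun a => ⟨isOpen_setOf_lt_coord hτ hD hs a, ?_⟩
      convert isOpen_setOf_lt_coord hτ hD (hτ.inv_mem s hs) (1 - a) using 1
      ext p
      rw [mem_ofPred_eq, (isCoord_coord hτ hD p).inv_eq hs, sub_lt_sub_iff_left]
      rfl
    · have : (fun p => coord hD p s) = fun _ => 0 :=
        funext fun p => (isCoord_coord hτ hD p).eq_zero s hs
      rw [this]
      exact continuous_const
  refine ⟨⟨le_antisymm hcont.le_induced (le_generateFrom ?_)⟩, coord_injective hτ hD⟩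
  classical
  rintro _ ⟨s, hs, r, hr, rfl⟩
  refine ⟨{f | (if s ∈ D then r else 1 - r) < f s},
    isOpen_lt continuous_const (continuous_apply s), ?_⟩
  ext p
  exact (mem_subbasic_iff hτ hD hs hr p).symm

theorem range_coord (hτ : IsRegularTreeSet τ) (hD : IsOrientation τ D) :
    range (coord hD) = {f | IsCoord τ f} :=
  Set.ext fun _ => ⟨by rintro ⟨p, rfl⟩; exact isCoord_coord hτ hD p,
    fun hf => hf.exists_coord_eq hτ hD⟩

theorem compactSpace_treeTopology (hτ : IsRegularTreeSet τ) (hD : IsOrientation τ D) :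
    @CompactSpace _ (treeTopology τ D) := by
  let _ := treeTopology τ D
  refine ⟨(isEmbedding_coord hτ hD).isCompact_iff.2 ?_⟩
  rw [image_univ, range_coord hτ hD]
  exact isCompact_setOf_isCoord

end TreePoints

end SeparationSystem

/-! ### Transport of graph-like structures, and contractions as minors -/

theorem IsGraphLike.of_homeomorph {P P' E E' : Type*} [TopologicalSpace P] [TopologicalSpace P']
    {V : Set P} {ι : E → unitInterval → P} (h : IsGraphLike V ι) (φ : P' ≃ₜ P) (σ : E' ≃ E)
    {V' : Set P'} {ι' : E' → unitInterval → P'} (hV : V' = φ ⁻¹' V)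
    (hι : ∀ e x, φ (ι' e x) = ι (σ e) x) : IsGraphLike V' ι' := by
  subst hV
  have hι' : ∀ e x, ι' e x = φ.symm (ι (σ e) x) := fun e x => by rw [← hι, φ.symm_apply_apply]
  refine ⟨fun e => ?_, fun p => ?_, fun e e' x x' h0 h1 h0' h1' heq => ?_, fun e => ?_,
    fun e => ?_, fun e s hs hs' => ?_, fun v hv v' hv' hne => ?_, ?_⟩
  · exact (φ.symm.continuous.comp (h.continuous (σ e))).congr fun x => (hι' e x).symm
  · refine (h.compl_vertices (φ p)).trans ⟨?_, ?_⟩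
    · rintro ⟨e, x, h0, h1, hx⟩
      exact ⟨σ.symm e, x, h0, h1, by rw [hι', σ.apply_symm_apply, hx, φ.symm_apply_apply]⟩
    · rintro ⟨e, x, h0, h1, rfl⟩
      exact ⟨σ e, x, h0, h1, (hι e x).symm⟩
  · have := h.injective (σ e) (σ e') x x' h0 h1 h0' h1' (by rw [← hι, ← hι, heq])
    exact ⟨σ.injective this.1, this.2⟩
  · rw [Set.mem_preimage, hι]
    exact h.zero_mem _
  · rw [Set.mem_preimage, hι]
    exact h.one_mem _
  · have := φ.symm.isOpenMap _ (h.isOpen_image (σ e) s hs hs')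
    rwa [Set.image_image, ← funext (hι' e)] at this
  · obtain ⟨U, U', hU, hU', hd, hc, h1, h2⟩ := h.separated _ hv _ hv' (φ.injective.ne hne)
    exact ⟨φ ⁻¹' U, φ ⁻¹' U', hU.preimage φ.continuous, hU'.preimage φ.continuous, hd.preimage _,
      fun p hp => hc hp, h1, h2⟩
  · have := h.hausdorff
    exact φ.symm.t2Space

namespace GraphLikeSpace

theorem IsIsomorphic.trans {G H K : GraphLikeSpace} (h : G.IsIsomorphic H)
    (h' : H.IsIsomorphic K) : G.IsIsomorphic K := by
  obtain ⟨φ, hφ⟩ := h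
  obtain ⟨ψ, hψ⟩ := h'
  exact ⟨φ.trans ψ, hψ.comp hφ⟩

/-- Deleting nothing still passes to a subtype, so a contraction is a minor only up to this
homeomorphism. -/
theorem exists_homeomorph_bijOn {P : Type*} [TopologicalSpace P] {A : Set P} (hA : ∀ p, p ∈ A)
    (V : Set P) : ∃ φ : P ≃ₜ A, Set.BijOn φ V (Subtype.val ⁻¹' V) :=
  ⟨(Homeomorph.Set.univ P).symm.trans (Homeomorph.setCongr (Set.eq_univ_of_forall hA).symm),
    fun _ hp => hp, fun _ _ _ _ h => congrArg Subtype.val h, fun p hp => ⟨p.1, hp, rfl⟩⟩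

theorem isIsomorphic_deleteEdges_of_eq_empty (G : GraphLikeSpace) {F : Set G.Edge} (hF : F = ∅) :
    G.IsIsomorphic (G.deleteEdges F) :=
  exists_homeomorph_bijOn (by
    rintro p ⟨e, he, -⟩
    exact (hF ▸ he : e ∈ (∅ : Set G.Edge))) _

theorem isIsomorphic_deleteVertices_of_eq_empty (G : GraphLikeSpace) {W : Set G.Point}
    (hW : W = ∅) (h : G.IsNonEndVertexSet W) : G.IsIsomorphic (G.deleteVertices W h) :=
  exists_homeomorph_bijOn (fun p hp => (hW ▸ hp : p ∈ (∅ : Set G.Point))) _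

theorem IsIsomorphic.isMinor_of_contract {G H : GraphLikeSpace} {F : Set H.Edge}
    (h : G.IsIsomorphic (H.contract F)) : G.IsMinor H :=
  ⟨F, ∅, Set.disjoint_empty F, ∅, ⟨Set.empty_subset _, fun _ => ⟨id, id⟩⟩,
    (h.trans (isIsomorphic_deleteEdges_of_eq_empty _ rfl)).trans
      (isIsomorphic_deleteVertices_of_eq_empty _ rfl _)⟩

end GraphLikeSpace

namespace SeparationSystem

/-! ### The restriction map from T(τ₂) to T(τ₁) -/

section Restriction

open Set
open scoped Topology

variable {α : Type*} [SeparationSystem α] {τ₁ τ₂ D₁ D₂ : Set α}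
  (h₁ : IsRegularTreeSet τ₁) (h₂ : IsRegularTreeSet τ₂) (hsub : τ₁ ⊆ τ₂)
  (hD₁ : IsOrientation τ₁ D₁) (hD₂ : IsOrientation τ₂ D₂)

/-- The map from `T(τ₂)` to `T(τ₁)` that restricts orientations to `τ₁`, fixes the edges of `τ₁`
and contracts the other edges. -/
noncomputable def restrictPoint (p : TreePoint τ₂) : TreePoint τ₁ :=
  (((isCoord_coord h₂ hD₂ p).indicator h₁ hsub).exists_coord_eq h₁ hD₁).choose

theorem coord_restrictPoint (p : TreePoint τ₂) :
    coord hD₁ (restrictPoint h₁ h₂ hsub hD₁ hD₂ p) = τ₁.indicator (coord hD₂ p) :=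
  (((isCoord_coord h₂ hD₂ p).indicator h₁ hsub).exists_coord_eq h₁ hD₁).choose_spec

/-- Describes the fibres by prescribed coordinates on `τ₁`, the form in which their connectedness is
known. -/
theorem restrictPoint_eq_iff {p : TreePoint τ₂} {q : TreePoint τ₁} :
    restrictPoint h₁ h₂ hsub hD₁ hD₂ p = q ↔ ∀ t ∈ τ₁, coord hD₂ p t = coord hD₁ q t := by
  rw [← (coord_injective h₁ hD₁).eq_iff, coord_restrictPoint]
  refine ⟨fun h t ht => by rw [← h, indicator_of_mem ht], fun h => funext fun t => ?_⟩
  by_cases ht : t ∈ τ₁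
  · rw [indicator_of_mem ht, h t ht]
  · rw [indicator_of_notMem ht, (isCoord_coord h₁ hD₁ q).eq_zero t ht]

theorem restrictPoint_surjective :
    Function.Surjective (restrictPoint h₁ h₂ hsub hD₁ hD₂) := by
  intro q
  obtain ⟨g, hg, hgq⟩ := (isCoord_coord h₁ hD₁ q).exists_indicator_eq h₁ h₂ hsub
  obtain ⟨p, rfl⟩ := hg.exists_coord_eq h₂ hD₂
  exact ⟨p, coord_injective h₁ hD₁ ((coord_restrictPoint h₁ h₂ hsub hD₁ hD₂ p).trans hgq)⟩

/-- A continuous surjection from a compact space to a Hausdorff space is closed. Continuity is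
checked coordinatewise. -/
theorem isQuotientMap_restrictPoint :
    @Topology.IsQuotientMap _ _ (treeTopology τ₂ D₂) (treeTopology τ₁ D₁)
      (restrictPoint h₁ h₂ hsub hD₁ hD₂) := by
  let _ : TopologicalSpace (TreePoint τ₂) := treeTopology τ₂ D₂
  let _ : TopologicalSpace (TreePoint τ₁) := treeTopology τ₁ D₁
  have : CompactSpace (TreePoint τ₂) := compactSpace_treeTopology h₂ hD₂
  have : T2Space (TreePoint τ₁) := (isGraphLike_tree h₁ hD₁).hausdorff
  have hcont : Continuous (restrictPoint h₁ h₂ hsub hD₁ hD₂) := by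
    rw [(isEmbedding_coord h₁ hD₁).continuous_iff]
    have : coord hD₁ ∘ restrictPoint h₁ h₂ hsub hD₁ hD₂ = fun p => τ₁.indicator (coord hD₂ p) :=
      funext fun p => coord_restrictPoint h₁ h₂ hsub hD₁ hD₂ p
    rw [this]
    refine continuous_pi fun t => ?_
    by_cases ht : t ∈ τ₁
    · simp only [indicator_of_mem ht]
      exact (continuous_apply t).comp (isEmbedding_coord h₂ hD₂).continuous
    · simp only [indicator_of_notMem ht]
      exact continuous_const
  exact hcont.isClosedMap.isQuotientMap hcont (restrictPoint_surjective h₁ h₂ hsub hD₁ hD₂)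

theorem isPreconnected_restrictPoint_fiber (q : TreePoint τ₁) :
    @IsPreconnected _ (treeTopology τ₂ D₂) (restrictPoint h₁ h₂ hsub hD₁ hD₂ ⁻¹' {q}) := by
  let _ : TopologicalSpace (TreePoint τ₂) := treeTopology τ₂ D₂
  rw [← (isEmbedding_coord h₂ hD₂).isInducing.isPreconnected_image]
  convert isPreconnected_setOf_isCoord h₂ τ₁ (coord hD₁ q) using 1
  ext f
  constructor
  · rintro ⟨p, hp, rfl⟩
    exact ⟨isCoord_coord h₂ hD₂ p, (restrictPoint_eq_iff h₁ h₂ hsub hD₁ hD₂).1 hp⟩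
  · rintro ⟨hf, h⟩
    obtain ⟨p, rfl⟩ := hf.exists_coord_eq h₂ hD₂
    exact ⟨p, (restrictPoint_eq_iff h₁ h₂ hsub hD₁ hD₂).2 h, rfl⟩

theorem orient_notMem {e : UnorientedSep τ₂} (he : e ∉ edgesOf τ₁ τ₂) : orient hD₂ e ∉ τ₁ :=
  fun h => he ⟨_, h, coe_eq_unoriented e (orient_mem_edge hD₂ e)⟩

theorem orient_mem_of_mem_edgesOf (h₁ : IsRegularTreeSet τ₁) {e : UnorientedSep τ₂} (he : e ∈ edgesOf τ₁ τ₂) :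
    orient hD₂ e ∈ τ₁ := by
  obtain ⟨s, hs, hes⟩ := he
  have := orient_mem_edge hD₂ e
  rw [hes] at this
  rcases this with h | h <;> rw [h]
  · exact hs
  · exact h₁.inv_mem s hs

end Restriction

/-! ### The contraction relation is the kernel of restriction -/

section Contraction

open Set
open scoped Topology

variable {α : Type*} [SeparationSystem α] {τ₁ τ₂ D₁ D₂ : Set α}
  (h₁ : IsRegularTreeSet τ₁) (h₂ : IsRegularTreeSet τ₂) (hsub : τ₁ ⊆ τ₂)
  (hD₁ : IsOrientation τ₁ D₁) (hD₂ : IsOrientation τ₂ D₂)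

theorem restrictPoint_treeι_of_notMem {e : UnorientedSep τ₂} (he : e ∉ edgesOf τ₁ τ₂)
    (x y : unitInterval) :
    restrictPoint h₁ h₂ hsub hD₁ hD₂ (treeι h₂ hD₂ e x) =
      restrictPoint h₁ h₂ hsub hD₁ hD₂ (treeι h₂ hD₂ e y) := by
  apply coord_injective h₁ hD₁
  rw [coord_restrictPoint, coord_restrictPoint, coord_treeι, coord_treeι]
  exact indicator_edgeCoord_of_notMem h₁ (orient_notMem hD₂ he) _ _

/-- The hypothesis that both orientations direct the edge alike is essential: otherwise the edge
would be traversed backwards. -/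
theorem restrictPoint_treeι {e : UnorientedSep τ₂} {f : UnorientedSep τ₁}
    (hef : orient hD₁ f = orient hD₂ e) (x : unitInterval) :
    restrictPoint h₁ h₂ hsub hD₁ hD₂ (treeι h₂ hD₂ e x) = treeι h₁ hD₁ f x := by
  apply coord_injective h₁ hD₁
  rw [coord_restrictPoint, coord_treeι, coord_treeι, hef]
  exact indicator_edgeCoord h₁ hsub (hef ▸ orient_mem_tree hD₁ f) _

theorem restrictPoint_mem_range_vertex {p : TreePoint τ₂} (hp : p ∈ range TreePoint.vertex) :
    restrictPoint h₁ h₂ hsub hD₁ hD₂ p ∈ range TreePoint.vertex := by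
  rw [mem_range_vertex_iff hD₂] at hp
  rw [mem_range_vertex_iff hD₁, coord_restrictPoint]
  intro s
  by_cases hs : s ∈ τ₁
  · rw [indicator_of_mem hs]
    exact hp s
  · exact Or.inl (indicator_of_notMem hs _)

/-- An inner point of an edge of `τ₁` keeps its fractional coordinate, so it cannot restrict to a
vertex. -/
theorem exists_treeι_eq_of_restrictPoint_mem {p : TreePoint τ₂}
    (hp : restrictPoint h₁ h₂ hsub hD₁ hD₂ p ∈ range TreePoint.vertex) :
    p ∈ range TreePoint.vertex ∨ ∃ e ∉ edgesOf τ₁ τ₂, ∃ x, treeι h₂ hD₂ e x = p := by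
  rcases p with O | ⟨e, x⟩
  · exact Or.inl ⟨O, rfl⟩
  · refine Or.inr ⟨e, fun he => ?_, ⟨x, x.2.1.le, x.2.2.le⟩, treeι_inner h₂ hD₂ e x.2.1 x.2.2⟩
    have := (mem_range_vertex_iff hD₁ _).1 hp (orient hD₂ e)
    rw [coord_restrictPoint, indicator_of_mem (orient_mem_of_mem_edgesOf hD₂ h₁ he),
      coord_inner_orient] at this
    exact this.elim x.2.1.ne' x.2.2.ne

/-- Every contracting relation identifies points with the same restriction. -/
theorem ker_restrictPoint_le_of_isContracting {r : Setoid (TreePoint τ₂)}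
    (hr : (treeLikeSpace h₂ hD₂).IsContracting (edgesOf τ₁ τ₂)ᶜ r) :
    Setoid.ker (restrictPoint h₁ h₂ hsub hD₁ hD₂) ≤ r := by
  let _ : TopologicalSpace (TreePoint τ₂) := treeTopology τ₂ D₂
  intro p q hpq
  set π := restrictPoint h₁ h₂ hsub hD₁ hD₂ with hπ
  change π p = π q at hpq
  by_cases hv : π q ∈ range TreePoint.vertex
  -- Every point of the fibre is a vertex or lies on a collapsed edge, where `r` identifies it with
  -- an end-vertex.
  · have hV : ∀ a, π a = π q → Quotient.mk r a ∈ Quotient.mk r '' range TreePoint.vertex := by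
      intro a ha
      rcases exists_treeι_eq_of_restrictPoint_mem h₁ h₂ hsub hD₁ hD₂ (ha ▸ hv) with
        ha | ⟨e, he, x, rfl⟩
      · exact ⟨a, ha, rfl⟩
      · exact ⟨_, (isGraphLike_tree h₂ hD₂).zero_mem e, Quotient.sound (hr.1 e he 0 x)⟩
    by_contra hne
    have hr2 : IsGraphLike (P := Quotient r) _ _ := hr.2
    -- Were the two classes distinct, the preimages of `U` and `U'` would disconnect the fibre.
    obtain ⟨U, U', hU, hU', hd, hc, h1, h2⟩ := hr2.separated _ (hV p hpq) _ (hV q rfl)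
      (fun h => hne (Quotient.exact h))
    have hcont : Continuous (Quotient.mk r) := continuous_quotient_mk'
    obtain ⟨a, -, ha, ha'⟩ := isPreconnected_restrictPoint_fiber h₁ h₂ hsub hD₁ hD₂ (π q)
      _ _ (hU.preimage hcont) (hU'.preimage hcont) (fun a ha => hc (hV a ha))
      ⟨p, hpq, h1⟩ ⟨q, rfl, h2⟩
    exact disjoint_left.1 hd ha ha'
  · rw [mem_range_vertex_iff hD₁] at hv
    push Not at hv
    obtain ⟨s, h0, h1⟩ := hv
    have hs : s ∈ τ₁ := by_contra fun h => h0 ((isCoord_coord h₁ hD₁ _).eq_zero s h)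
    have hps := (restrictPoint_eq_iff h₁ h₂ hsub hD₁ hD₂).1 hpq s hs
    have hqs := (restrictPoint_eq_iff h₁ h₂ hsub hD₁ hD₂).1 (rfl : π q = π q) s hs
    -- A common fractional value at `s` determines all coordinates, so this fibre is a single point.
    have : p = q := by
      apply coord_injective h₂ hD₂
      rw [(isCoord_coord h₂ hD₂ p).eq_edgeCoord h₂ (hsub hs) (hps ▸ h0) (hps ▸ h1),
        (isCoord_coord h₂ hD₂ q).eq_edgeCoord h₂ (hsub hs) (hqs ▸ h0) (hqs ▸ h1), hps, hqs]
    exact this ▸ r.refl p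

/-- Each fibre over a vertex contains a vertex, because a collapsed edge lies in one fibre together
with its ends. -/
theorem image_mk_range_vertex (φ : Quotient (Setoid.ker (restrictPoint h₁ h₂ hsub hD₁ hD₂)) →
      TreePoint τ₁)
    (hφ : ∀ p, φ (Quotient.mk _ p) = restrictPoint h₁ h₂ hsub hD₁ hD₂ p) :
    Quotient.mk (Setoid.ker (restrictPoint h₁ h₂ hsub hD₁ hD₂)) '' range TreePoint.vertex =
      φ ⁻¹' range TreePoint.vertex := by
  let _ : TopologicalSpace (TreePoint τ₂) := treeTopology τ₂ D₂
  ext c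
  constructor
  · rintro ⟨p, hp, rfl⟩
    rw [mem_preimage, hφ]
    exact restrictPoint_mem_range_vertex h₁ h₂ hsub hD₁ hD₂ hp
  · induction c using Quotient.inductionOn with
    | h p =>
      intro hp
      rw [mem_preimage, hφ] at hp
      rcases exists_treeι_eq_of_restrictPoint_mem h₁ h₂ hsub hD₁ hD₂ hp with
        hp | ⟨e, he, x, rfl⟩
      · exact ⟨p, hp, rfl⟩
      · exact ⟨_, (isGraphLike_tree h₂ hD₂).zero_mem e,
          Quotient.sound (restrictPoint_treeι_of_notMem h₁ h₂ hsub hD₁ hD₂ he 0 x)⟩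

/-- The edges of `T(τ₂)` that belong to `τ₁` are the edges of `T(τ₁)`. -/
def edgesOfEquiv (hsub : τ₁ ⊆ τ₂) :
    {e : UnorientedSep τ₂ // e ∉ (edgesOf τ₁ τ₂)ᶜ} ≃ UnorientedSep τ₁ where
  toFun e := ⟨e.1.1, not_not.1 e.2⟩
  invFun f := ⟨⟨f.1, f.2.imp fun _ h => ⟨hsub h.1, h.2⟩⟩, not_not.2 f.2⟩
  left_inv _ := rfl
  right_inv _ := rfl

theorem IsOrientation.inter (h₁ : IsRegularTreeSet τ₁) (hsub : τ₁ ⊆ τ₂)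
    (hD₂ : IsOrientation τ₂ D₂) : IsOrientation τ₁ (D₂ ∩ τ₁) where
  subset := inter_subset_right
  existsUnique s hs := by
    obtain ⟨x, ⟨hx, hxs⟩, hu⟩ := hD₂.existsUnique s (hsub hs)
    refine ⟨x, ⟨⟨hx, ?_⟩, hxs⟩, fun y hy => hu y ⟨hy.1.1, hy.2⟩⟩
    rcases hxs with rfl | rfl
    · exact hs
    · exact h₁.inv_mem s hs

/-- If the edges of `τ₁` are directed as in `τ₂`, then restriction is a contraction. -/
theorem isContracting_ker_restrictPoint_inter :
    (treeLikeSpace h₂ hD₂).IsContracting (edgesOf τ₁ τ₂)ᶜ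
      (Setoid.ker (restrictPoint h₁ h₂ hsub (hD₂.inter h₁ hsub) hD₂)) := by
  let _ : TopologicalSpace (TreePoint τ₂) := treeTopology τ₂ D₂
  let _ : TopologicalSpace (TreePoint τ₁) := treeTopology τ₁ (D₂ ∩ τ₁)
  have hD := hD₂.inter h₁ hsub
  refine ⟨fun e he x y => restrictPoint_treeι_of_notMem h₁ h₂ hsub hD hD₂ he x y, ?_⟩
  have hq := isQuotientMap_restrictPoint h₁ h₂ hsub hD hD₂
  let φ := Topology.IsQuotientMap.homeomorph (f := ⟨_, hq.continuous⟩) hq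
  refine (isGraphLike_tree h₁ hD).of_homeomorph φ (edgesOfEquiv hsub)
    (image_mk_range_vertex h₁ h₂ hsub hD hD₂ φ fun _ => rfl) fun e x => ?_
  refine restrictPoint_treeι h₁ h₂ hsub hD hD₂ ?_ x
  exact orient_eq_of_mem hD ⟨orient_mem hD₂ e.1,
    orient_mem_of_mem_edgesOf hD₂ h₁ (not_not.1 e.2)⟩ (orient_mem_edge hD₂ e.1)

/-- The kernel means equality of the coordinates on `τ₁`, and so does not see how the edges of T(τ₁)
are directed. -/
theorem ker_restrictPoint_eq {D D' : Set α} (hD : IsOrientation τ₁ D) (hD' : IsOrientation τ₁ D') :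
    Setoid.ker (restrictPoint h₁ h₂ hsub hD hD₂) =
      Setoid.ker (restrictPoint h₁ h₂ hsub hD' hD₂) := by
  ext p q
  rw [Setoid.ker_def, Setoid.ker_def, ← (coord_injective h₁ hD).eq_iff,
    ← (coord_injective h₁ hD').eq_iff]
  simp only [coord_restrictPoint]

theorem contractionRel_treeLikeSpace :
    (treeLikeSpace h₂ hD₂).contractionRel (edgesOf τ₁ τ₂)ᶜ =
      Setoid.ker (restrictPoint h₁ h₂ hsub hD₁ hD₂) := by
  refine le_antisymm ?_ (ker_restrictPoint_le_of_isContracting h₁ h₂ hsub hD₁ hD₂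
    (GraphLikeSpace.isContracting_contractionRel _ _))
  -- A contracting relation must induce the edge maps of T(τ₂), and these match the edge maps of
  -- T(τ₁) when its edges are directed by `D₂ ∩ τ₁`.
  rw [ker_restrictPoint_eq h₁ h₂ hsub hD₂ hD₁ (hD₂.inter h₁ hsub)]
  exact GraphLikeSpace.contractionRel_le (isContracting_ker_restrictPoint_inter h₁ h₂ hsub hD₂)

theorem isIsomorphic_contractTo (hsub : τ₁ ⊆ τ₂) :
    (treeLikeSpace h₁ hD₁).IsIsomorphic
      ((treeLikeSpace h₂ hD₂).contractTo (edgesOf τ₁ τ₂)) := by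
  let _ : TopologicalSpace (TreePoint τ₂) := treeTopology τ₂ D₂
  let _ : TopologicalSpace (TreePoint τ₁) := treeTopology τ₁ D₁
  -- The quotient space depends on the relation, so the relation is kept variable until the equality
  -- is substituted.
  have key : ∀ r : Setoid (TreePoint τ₂), r = Setoid.ker (restrictPoint h₁ h₂ hsub hD₁ hD₂) →
      ∃ φ : TreePoint τ₁ ≃ₜ Quotient r,
        BijOn φ (range TreePoint.vertex) (Quotient.mk r '' range TreePoint.vertex) := by
    rintro _ rfl
    have hq := isQuotientMap_restrictPoint h₁ h₂ hsub hD₁ hD₂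
    let φ := Topology.IsQuotientMap.homeomorph (f := ⟨_, hq.continuous⟩) hq
    refine ⟨φ.symm, ?_⟩
    rw [image_mk_range_vertex h₁ h₂ hsub hD₁ hD₂ φ fun _ => rfl, ← φ.image_symm]
    exact φ.symm.injective.injOn.bijOn_image
  exact key _ (contractionRel_treeLikeSpace h₁ h₂ hsub hD₁ hD₂)

end Contraction

end SeparationSystem

theorem mainTheorem3 {α : Type*} [SeparationSystem α] (τ₁ τ₂ : Set α)
    (h₁ : SeparationSystem.IsRegularTreeSet τ₁) (h₂ : SeparationSystem.IsRegularTreeSet τ₂)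
    (hsub : τ₁ ⊆ τ₂)
    (D₁ D₂ : Set α) (hD₁ : SeparationSystem.IsOrientation τ₁ D₁)
    (hD₂ : SeparationSystem.IsOrientation τ₂ D₂) :
    (SeparationSystem.treeLikeSpace h₁ hD₁).IsMinor (SeparationSystem.treeLikeSpace h₂ hD₂) ∧
    (SeparationSystem.treeLikeSpace h₁ hD₁).IsIsomorphic
      ((SeparationSystem.treeLikeSpace h₂ hD₂).contractTo
        (SeparationSystem.edgesOf τ₁ τ₂)) :=
  have h := SeparationSystem.isIsomorphic_contractTo h₁ h₂ hD₁ hD₂ hsub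
  ⟨h.isMinor_of_contract, h⟩
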